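/- **Model.** For every number $m$ of items let $k=k(m)$ be a number of players that is subexponential in $m$, and let $\mathcal V=\mathcal V_m$ be a class of valuations on the item set $M$, $|M|=m$: functions $v:2^M\to\mathbb Z_{\ge 0}$ that are monotone with $v(\emptyset)=0$ and whose values have description length (number of bits) bounded by a fixed polynomial in $k$ and $m$. An allocation gives pairwise disjoint bundles $T_1,\dots,T_k\subseteq M$ to the players; its welfare is $\sum_i v_i(T_i)$. "Subexponential" means $2^{o(m)}$ and "exponential" means $2^{\Omega(m)}$; alternatively "subexponential" means $2^{m^{o(1)}}$ and "exponential" means $2^{m^{\Omega(1)}}$. The theorem holds under either convention, used consistently. "Sub-doubly-exponential" means at most $2^{f(m)}$ with $f$ subexponential. A nondeterministic protocol of cost $c$ consists of a prover who sees all the valuations and writes a proof of $c$ bits on a public blackboard, and of $k$ players who each accept or reject on the basis of the proof and of their own valuation only; an input $(v_1,\dots,v_k)$ is accepted if some proof makes all the players accept. Given $W^*=W^*(m)>0$ and $\alpha=\alpha(m)\ge 1$ (for instance constant), a protocol certifies the 1-inputs of the following promise problem if, among the inputs with all $v_i\in\mathcal V$, it accepts all the 1-inputs and no 0-input: - (1)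 every allocation has welfare at most $W^*/\alpha$; - (0) there exists an allocation with welfare at least $W^*$. An auction consists of a finite nonempty strategy set for each player, and of rules that determine, from the strategies chosen, an allocation $(T_1,\dots,T_k)$ and real payments $p_1,\dots,p_k$; the payoff of player $i$ is $v_i(T_i)-p_i$. A profile of independent mixed strategies is an $\varepsilon$-approximate Nash equilibrium if no player $i$ can increase her expected payoff by a unilateral deviation by more than $\varepsilon$, where her payoffs are scaled to lie in $[-1,1]$ (that is, by more than $\varepsilon$ times the maximum absolute value of a payoff of player $i$ over all strategy profiles). The price of anarchy (POA) for $v_1,\dots,v_k$ is the maximum welfare of an allocation divided by the infimum of the expected welfare over all $\varepsilon$-approximate Nash equilibria (with $x/0=\infty$ for $x>0$ and $0/0=0$); the worst-case POA for $\mathcal V$ is its supremum over all $v_1,\dots,v_k\in\mathcal V$. **Theorem.** Let $\varepsilon=\varepsilon(m)$ be bounded below by an inverse polynomial function of $k$ and $m$. (a) Suppose that there is no family of nondeterministic protocols, one for each $m$, whose cost is subexponential in $m$ and which certify the 1-inputs of the promise problem for all sufficiently large $m$. Then for every family of auctions (one for each $m$, with $m$ items and $k(m)$ players) with a sub-doubly-exponential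 (in $m$) number of strategies per player, the worst-case POA of $\varepsilon$-approximate Nash equilibria with valuations in $\mathcal V$ is at least $\alpha$ for infinitely many $m$. (b) Suppose that there is an exponential function of $m$ such that, for all sufficiently large $m$, every nondeterministic protocol that certifies the 1-inputs of the promise problem has at least that cost. Then for every family of auctions as in (a), the worst-case POA of $\varepsilon$-approximate Nash equilibria with valuations in $\mathcal V$ is at least $\alpha$ for all sufficiently large $m$. -/

import Mathlib

open Filter

noncomputable section

namespace CombAuction

/-! ### Valuations, allocations, welfare -/

/-- A valuation on `m` items: a monotone function from bundles to the nonnegative integers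
that vanishes on the empty bundle. -/
structure Valuation (m : ℕ) where
  val : Finset (Fin m) → ℕ
  val_empty : val ∅ = 0
  mono : Monotone val

/-- An allocation of `m` items to `k` players: every item goes to at most one player.
Items may stay unsold; as valuations are monotone, this does not affect the maximum welfare. -/
abbrev Allocation (k m : ℕ) : Type := Fin m → Option (Fin k)

/-- The bundle that player `i` receives. -/
def Allocation.bundle {k m : ℕ} (T : Allocation k m) (i : Fin k) : Finset (Fin m) :=
  Finset.univ.filter fun j => T j = some i

/-- The social welfare of an allocation. -/
def welfare {k m : ℕ} (v : Fin k → Valuation m) (T : Allocation k m) : ℝ :=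
  ∑ i, ((v i).val (T.bundle i) : ℝ)

/-- The maximum social welfare (a maximum over a finite nonempty set). -/
def optWelfare {k m : ℕ} (v : Fin k → Valuation m) : ℝ :=
  ⨆ T : Allocation k m, welfare v T

/-! ### Nondeterministic protocols for the promise problem -/

/-- (1): every allocation has welfare at most `W / α`. -/
def IsOneInput {k m : ℕ} (W α : ℝ) (v : Fin k → Valuation m) : Prop :=
  ∀ T : Allocation k m, welfare v T ≤ W / α

/-- (0): some allocation has welfare at least `W`. -/
def IsZeroInput {k m : ℕ} (W : ℝ) (v : Fin k → Valuation m) : Prop :=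
  ∃ T : Allocation k m, W ≤ welfare v T

/-- A `k`-player nondeterministic protocol in the number-in-hand blackboard model: a prover who
sees all inputs writes `cost` bits on a public blackboard, and every player, who sees the
blackboard and her own valuation only, accepts or rejects. -/
structure NondetProtocol (k m : ℕ) where
  cost : ℕ
  playerAccepts : Fin k → (Fin cost → Bool) → Valuation m → Prop

/-- An input is accepted if some proof makes all the players accept. -/
def NondetProtocol.Accepts {k m : ℕ} (P : NondetProtocol k m) (v : Fin k → Valuation m) : Prop :=
  ∃ proof : Fin P.cost → Bool, ∀ i, P.playerAccepts i proof (v i)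

/-- The protocol certifies the 1-inputs of the promise problem, for valuations in `V`: it accepts
the 1-inputs and rejects the 0-inputs, and may do anything on all other inputs. -/
def NondetProtocol.Solves {k m : ℕ} (P : NondetProtocol k m) (V : Set (Valuation m))
    (W α : ℝ) : Prop :=
  ∀ v : Fin k → Valuation m, (∀ i, v i ∈ V) →
    (IsOneInput W α v → P.Accepts v) ∧ (IsZeroInput W v → ¬ P.Accepts v)

/-! ### Auctions as games -/

/-- An auction for `k` players and `m` items: finite nonempty strategy sets, an allocation rule
and a payment rule. -/
structure Auction (k m : ℕ) where
  Strategy : Fin k → Type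
  fintypeStrategy : ∀ i, Fintype (Strategy i)
  nonemptyStrategy : ∀ i, Nonempty (Strategy i)
  alloc : (∀ i, Strategy i) → Allocation k m
  payment : (∀ i, Strategy i) → Fin k → ℝ

attribute [instance] Auction.fintypeStrategy Auction.nonemptyStrategy

namespace Auction

variable {k m : ℕ}

/-- The largest number of strategies of a player. -/
def numStrategies (A : Auction k m) : ℕ :=
  Finset.univ.sup fun i => Fintype.card (A.Strategy i)

/-- Payoff of player `i`: the value of the items won minus the payment. -/
def utility (A : Auction k m) (v : Fin k → Valuation m) (i : Fin k) (s : ∀ i, A.Strategy i) : ℝ :=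
  ((v i).val ((A.alloc s).bundle i) : ℝ) - A.payment s i

/-- The largest absolute value of a payoff of player `i`. -/
def payoffScale (A : Auction k m) (v : Fin k → Valuation m) (i : Fin k) : ℝ :=
  ⨆ s : ∀ i, A.Strategy i, |A.utility v i s|

/-- Expectation of `f` when the players independently play the mixed strategies `σ i`. -/
def expect (A : Auction k m) (σ : ∀ i, A.Strategy i → ℝ) (f : (∀ i, A.Strategy i) → ℝ) : ℝ :=
  ∑ s : ∀ i, A.Strategy i, (∏ i, σ i (s i)) * f s

/-- `ε`-approximate (mixed) Nash equilibrium: no player can raise her expected payoff by more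
than `ε` by a unilateral deviation, where her payoffs are scaled to lie in `[-1, 1]`. -/
def IsApproxNash (A : Auction k m) (v : Fin k → Valuation m) (ε : ℝ)
    (σ : ∀ i, A.Strategy i → ℝ) : Prop :=
  (∀ i, σ i ∈ stdSimplex ℝ (A.Strategy i)) ∧
    ∀ i, ∀ τ ∈ stdSimplex ℝ (A.Strategy i),
      A.expect (Function.update σ i τ) (A.utility v i) ≤
        A.expect σ (A.utility v i) + ε * A.payoffScale v i

/-- The expected social welfare of a profile of mixed strategies. -/
def expectedWelfare (A : Auction k m) (v : Fin k → Valuation m)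
    (σ : ∀ i, A.Strategy i → ℝ) : ℝ :=
  A.expect σ fun s => welfare v (A.alloc s)

/-- The price of anarchy of `ε`-approximate Nash equilibria for the valuations `v`: the ratio of
the maximum welfare and the smallest equilibrium welfare (`x / 0 = ∞` for `x > 0`, `0 / 0 = 0`). -/
def poa (A : Auction k m) (ε : ℝ) (v : Fin k → Valuation m) : ENNReal :=
  ENNReal.ofReal (optWelfare v) /
    ⨅ σ : {σ : ∀ i, A.Strategy i → ℝ // A.IsApproxNash v ε σ},
      ENNReal.ofReal (A.expectedWelfare v σ)

/-- The worst case of the price of anarchy over all profiles of valuations in `V`. -/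
def worstCasePoA (A : Auction k m) (ε : ℝ) (V : Set (Valuation m)) : ENNReal :=
  ⨆ v : {v : Fin k → Valuation m // ∀ i, v i ∈ V}, A.poa ε v

end Auction

/-! ### Growth rates -/

/-- The two usual conventions for subexponential growth in `m`:
`2 ^ o(m)` (`linear`) and `2 ^ (m ^ o(1))` (`power`). -/
inductive GrowthConvention where
  | linear
  | power

/-- The exponents with which growth is compared: `δ * m` or `m ^ δ`. -/
def GrowthConvention.exponent : GrowthConvention → ℝ → ℕ → ℝ
  | .linear, δ, m => δ * m
  | .power, δ, m => (m : ℝ) ^ δ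

/-- `f` is subexponential: it is eventually below every exponential function. -/
def Subexponential (g : GrowthConvention) (f : ℕ → ℝ) : Prop :=
  ∀ δ : ℝ, 0 < δ → ∀ᶠ m in atTop, f m ≤ (2 : ℝ) ^ g.exponent δ m

/-- `f` is sub-doubly-exponential: it is eventually below every doubly exponential function. -/
def SubDoublyExponential (g : GrowthConvention) (f : ℕ → ℝ) : Prop :=
  ∀ δ : ℝ, 0 < δ → ∀ᶠ m in atTop, f m ≤ (2 : ℝ) ^ ((2 : ℝ) ^ g.exponent δ m)

end CombAuction

end

open CombAuction

/-! The proof is by contraposition: an auction whose price of anarchy is below `α` yields a cheap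
protocol. In it the prover writes down an approximate equilibrium, together with each player's
expected value there. Each player can check alone that she has no profitable deviation, because her
payoff depends only on her own valuation, and that her stated value is correct. All check that the
stated values sum to at most `W / α`. On a 1-input every equilibrium passes the welfare test. On a
0-input an accepted proof would be an equilibrium of welfare at most `W / α` against an optimum of
at least `W`, so the price of anarchy would be at least `α`.

The equilibrium must have a short description. An exact mixed equilibrium exists by Nash's theorem,
proved here from Brouwer's theorem via Scarf's combinatorial lemma. Sampling from it gives an
approximate equilibrium (`Auction.exists_sparse_approxNash`) in which each player mixes uniformly
over a number of samples polynomial in `k`, `1 / ε` and the logarithm of the number of strategies.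
Expected values are then fractions with denominator `N ^ k`, so they can be written exactly. The
cost is polynomial in `k`, `m` and the logarithm of the number of strategies
(`Auction.exists_protocol_cost_le`), hence subexponential when the number of strategies is
sub-doubly-exponential. -/

/-! ### Scarf's lemma -/

section Scarf

variable {X I : Type*}

/-- No point is above the minima of `R` for all the orders `f i` at once. -/
def Dominant (f : I → X → ℕ) (R : Finset X) : Prop :=
  ∀ y, ∃ i, ∀ x ∈ R, f i y ≤ f i x

lemma Dominant.mono {f : I → X → ℕ} {R R' : Finset X} (h : R ⊆ R') (hR : Dominant f R') :
    Dominant f R := fun y =>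
  let ⟨i, hi⟩ := hR y
  ⟨i, fun x hx => hi x (h hx)⟩

variable [Fintype I]

/-- The index-wise minima of a dominant set with one element less than there are orders: exactly
two orders have the same minimum. -/
lemma Dominant.exists_minima {f : I → X → ℕ} (hf : ∀ i, Function.Injective (f i))
    {Y : Finset X} (hY : Dominant f Y) (hcard : Y.card + 1 = Fintype.card I)
    (hne : Y.Nonempty) :
    ∃ (μ : I → X) (a b : I), a ≠ b ∧ μ a = μ b ∧ (∀ i, μ i ∈ Y) ∧
      (∀ i, ∀ x ∈ Y, f i (μ i) ≤ f i x) ∧ (∀ x ∈ Y, ∃ i, μ i = x) ∧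
      (∀ i j, i ≠ j → μ i = μ j → (i = a ∧ j = b) ∨ (i = b ∧ j = a)) := by
  classical
  choose μ hμ hmin using fun i => Finset.exists_min_image Y (f i) hne
  have hsurj : ∀ x ∈ Y, ∃ i, μ i = x := by
    intro x hx
    obtain ⟨i, hi⟩ := hY x
    exact ⟨i, hf i (le_antisymm (hmin i x hx) (hi _ (hμ i)))⟩
  obtain ⟨a, -, b, -, hab, heq⟩ := Finset.exists_ne_map_eq_of_card_lt_of_maps_to
    (s := (Finset.univ : Finset I)) (t := Y) (f := μ) (by rw [Finset.card_univ]; omega)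
    (fun i _ => hμ i)
  -- Without `a` the map `μ` is still onto `Y`, now between sets of equal size, hence injective. The
  -- same holds without `b`, so the only collision is between `a` and `b`.
  have key : ∀ a b : I, a ≠ b → μ a = μ b → ∀ i j, i ≠ a → j ≠ a → μ i = μ j → i = j := by
    intro a b hab heq i j hi hj hij
    have := Finset.injOn_of_surjOn_of_card_le (s := Finset.univ.erase a) (t := Y) μ
      (fun i _ => hμ i) (by
        intro x hx
        obtain ⟨i, rfl⟩ := hsurj x hx
        by_cases h : i = a
        · exact ⟨b, by simpa using hab.symm, by rw [h, heq]⟩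
        · exact ⟨i, by simpa using h, rfl⟩)
      (by rw [Finset.card_erase_of_mem (Finset.mem_univ _), Finset.card_univ]; omega)
    exact this (by simpa using hi) (by simpa using hj) hij
  refine ⟨μ, a, b, hab, heq, hμ, hmin, hsurj, ?_⟩
  intro i j hij h
  have h1 := key a b hab heq i j
  have h2 := key b a hab.symm heq.symm i j
  have h3 := key a b hab heq j i
  grind

variable [DecidableEq X] [DecidableEq I]

/-- The rooms of a door are obtained by adding the largest point above all minima but one. -/
lemma Dominant.insert_iff {f : I → X → ℕ} (hf : ∀ i, Function.Injective (f i))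
    {Y : Finset X} (hY : Dominant f Y) {μ : I → X} {a b : I}
    (hμ : ∀ i, μ i ∈ Y) (hmin : ∀ i, ∀ x ∈ Y, f i (μ i) ≤ f i x)
    (hpair : ∀ i j, i ≠ j → μ i = μ j → (i = a ∧ j = b) ∨ (i = b ∧ j = a))
    {x : X} (hx : x ∉ Y) :
    Dominant f (insert x Y) ↔ ∃ j, (j = a ∨ j = b) ∧ (∀ i, i ≠ j → f i (μ i) < f i x) ∧
      ∀ y, (∀ i, i ≠ j → f i (μ i) < f i y) → f j y ≤ f j x := by
  constructor
  · intro h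
    -- The new point is the minimum in order `j`, so every old point must be the minimum in another
    -- order. This forces `j` into the pair sharing a minimum.
    obtain ⟨j, hj⟩ := h x
    have hpt : ∀ z ∈ Y, ∃ i, i ≠ j ∧ μ i = z ∧ f i z < f i x := by
      intro z hz
      have hzx : z ≠ x := fun h => hx (h ▸ hz)
      obtain ⟨i, hi⟩ := h z
      have h1 : f i z < f i x := lt_of_le_of_ne (hi x (by simp)) fun h => hzx (hf i h)
      refine ⟨i, ?_, hf i (le_antisymm (hmin i z hz) (hi _ (by simp [hμ]))), h1⟩
      rintro rfl
      exact absurd (hj z (by simp [hz])) (by omega)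
    have hjab : j = a ∨ j = b := by
      obtain ⟨i, hij, hi, -⟩ := hpt (μ j) (hμ j)
      have := hpair i j hij hi
      tauto
    refine ⟨j, hjab, ?_, ?_⟩
    · intro l hl
      obtain ⟨i, hij, hi, hlt⟩ := hpt (μ l) (hμ l)
      by_cases hil : i = l
      · rwa [hil] at hlt
      · have := hpair i l hil hi
        grind
    · intro y hy
      obtain ⟨l, hl⟩ := h y
      by_cases hlj : l = j
      · subst hlj
        exact hl x (by simp)
      · have := hy l hlj
        have := hl (μ l) (by simp [hμ])
        omega
  · rintro ⟨j, hj, hxj, hmax⟩ y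
    by_cases h : ∃ l, l ≠ j ∧ f l y ≤ f l (μ l)
    · obtain ⟨l, hlj, hl⟩ := h
      refine ⟨l, fun z hz => ?_⟩
      rcases Finset.mem_insert.1 hz with rfl | hz
      · exact hl.trans (hxj l hlj).le
      · exact hl.trans (hmin l z hz)
    · push Not at h
      refine ⟨j, fun z hz => ?_⟩
      rcases Finset.mem_insert.1 hz with rfl | hz
      · exact hmax y h
      · obtain ⟨l, hl⟩ := hY y
        by_cases hlj : l = j
        · subst hlj
          exact hl z hz
        · have := h l hlj
          have := hl (μ l) (hμ l)
          omega

/-- A door lies in exactly two rooms if there is a point above all minima but any given one. -/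
lemma Dominant.exists_two_rooms [Fintype X] {f : I → X → ℕ} (hf : ∀ i, Function.Injective (f i))
    {Y : Finset X} (hY : Dominant f Y) (hcard : Y.card + 1 = Fintype.card I)
    (hne : Y.Nonempty) (hup : ∀ j, ∃ y, ∀ i, i ≠ j → ∃ x ∈ Y, f i x < f i y) :
    ∃ x₁ x₂, x₁ ∉ Y ∧ x₂ ∉ Y ∧ x₁ ≠ x₂ ∧
      ∀ x, x ∉ Y → (Dominant f (insert x Y) ↔ x = x₁ ∨ x = x₂) := by
  obtain ⟨μ, a, b, hab, heq, hμ, hmin, hsurj, hpair⟩ := hY.exists_minima hf hcard hne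
  have hM : ∀ j, ∃ x, (∀ i, i ≠ j → f i (μ i) < f i x) ∧
      ∀ y, (∀ i, i ≠ j → f i (μ i) < f i y) → f j y ≤ f j x := by
    intro j
    obtain ⟨x, hx, hx'⟩ := Finset.exists_max_image
      (Finset.univ.filter fun y => ∀ i, i ≠ j → f i (μ i) < f i y) (f j) (by
        obtain ⟨y, hy⟩ := hup j
        refine ⟨y, ?_⟩
        simp only [Finset.mem_filter, Finset.mem_univ, true_and]
        intro i hi
        obtain ⟨x, hx, hlt⟩ := hy i hi
        exact (hmin i x hx).trans_lt hlt)
    simp only [Finset.mem_filter, Finset.mem_univ, true_and] at hx hx'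
    exact ⟨x, hx, hx'⟩
  choose g hg hgmax using hM
  -- As `a` and `b` share a minimum, every point of `Y` is the minimum in some order other than `j`,
  -- whereas `g j` lies strictly above all those minima.
  have hnot : ∀ j, (j = a ∨ j = b) → g j ∉ Y := by
    intro j hj hmem
    obtain ⟨i, hi'⟩ := hsurj _ hmem
    have : ∃ l, l ≠ j ∧ μ l = g j := by
      by_cases hij : i = j
      · rcases hj with rfl | rfl
        · exact ⟨b, hab.symm, by rw [← heq, ← hi', hij]⟩
        · exact ⟨a, hab, by rw [heq, ← hi', hij]⟩
      · exact ⟨i, hij, hi'⟩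
    obtain ⟨l, hlj, hl⟩ := this
    have := hg j l hlj
    rw [hl] at this
    omega
  refine ⟨g a, g b, hnot a (.inl rfl), hnot b (.inr rfl), ?_, ?_⟩
  -- A common value would lie strictly above the minima in all orders, against the dominance of `Y`.
  · intro h
    obtain ⟨i, hi⟩ := hY (g a)
    have h1 := hi _ (hμ i)
    by_cases hia : i = a
    · have := hg b i (hia ▸ hab)
      rw [← h] at this
      omega
    · have := hg a i hia
      omega
  · intro x hx
    rw [hY.insert_iff hf hμ hmin hpair hx]
    constructor
    · rintro ⟨j, hj, h1, h2⟩
      have : x = g j := hf j (le_antisymm (hgmax j x h1) (h2 _ (hg j)))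
      rcases hj with rfl | rfl <;> simp [this]
    · rintro (rfl | rfl)
      · exact ⟨a, .inl rfl, hg a, hgmax a⟩
      · exact ⟨b, .inr rfl, hg b, hgmax b⟩

/-- If a room is not colourful, an even number of its doors have all the colours but `i₀`. -/
lemma even_card_doors {c : X → I} {R : Finset X} (hR : R.card = Fintype.card I)
    (hc : R.image c ≠ Finset.univ) (i₀ : I) {D : Finset (Finset X)}
    (hD : ∀ Y, Y ⊆ R → (Y ∈ D ↔ Y.card + 1 = Fintype.card I ∧ Y.image c = Finset.univ.erase i₀)) :
    Even (D.filter (· ⊆ R)).card := by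
  rcases (D.filter (· ⊆ R)).eq_empty_or_nonempty with h | ⟨Y, hY⟩
  · simp [h]
  rw [Finset.mem_filter] at hY
  obtain ⟨hYD, hYR⟩ := hY
  obtain ⟨hYc, hYi⟩ := (hD Y hYR).1 hYD
  obtain ⟨x, hxY, rfl⟩ := Finset.exists_eq_insert_iff.2 ⟨hYR, hYc.trans hR.symm⟩
  have hinj : Set.InjOn c Y := by
    apply Finset.injOn_of_card_image_eq
    rw [hYi, Finset.card_erase_of_mem (Finset.mem_univ _), Finset.card_univ]
    omega
  have hcx : c x ≠ i₀ := by
    intro h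
    apply hc
    rw [Finset.image_insert, hYi, h, Finset.insert_erase (Finset.mem_univ _)]
  have hcx' : c x ∈ Y.image c := by
    rw [hYi]
    simpa using hcx
  obtain ⟨x', hx', hxx'⟩ := Finset.mem_image.1 hcx'
  have hne : x ≠ x' := fun h => hxY (h ▸ hx')
  -- The colours on `Y` are distinct and `x` repeats the colour of `x'`, so only deleting `x` or
  -- `x'` leaves a door.
  have hset : D.filter (· ⊆ insert x Y) = {Y, insert x (Y.erase x')} := by
    ext Z
    simp only [Finset.mem_filter, Finset.mem_insert, Finset.mem_singleton]
    constructor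
    · rintro ⟨hZD, hZ⟩
      obtain ⟨hZc, hZi⟩ := (hD Z hZ).1 hZD
      obtain ⟨z, hzZ, hz⟩ := Finset.exists_eq_insert_iff.2 ⟨hZ, hZc.trans hR.symm⟩
      have hZe : Z = (insert x Y).erase z := by rw [← hz, Finset.erase_insert hzZ]
      have hzm : z ∈ insert x Y := by rw [← hz]; simp
      rcases Finset.mem_insert.1 hzm with rfl | hzY
      · left
        rw [hZe, Finset.erase_insert hxY]
      · have hcz : c z ∈ Z.image c := by
          rw [hZi, ← hYi]
          exact Finset.mem_image_of_mem _ hzY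
        obtain ⟨w, hw, hwz⟩ := Finset.mem_image.1 hcz
        have hwne : w ≠ z := fun h => hzZ (h ▸ hw)
        have hwm := hZ hw
        rcases Finset.mem_insert.1 hwm with rfl | hwY
        · have : z = x' := hinj hzY hx' (by rw [← hwz, hxx'])
          right
          rw [hZe, this, Finset.erase_insert_of_ne hne]
        · exact absurd (hinj hwY hzY hwz) hwne
    · have hsub : insert x (Y.erase x') ⊆ insert x Y :=
        Finset.insert_subset_insert _ (Finset.erase_subset _ _)
      rintro (rfl | rfl)
      · exact ⟨hYD, hYR⟩
      · refine ⟨(hD _ hsub).2 ⟨?_, ?_⟩, hsub⟩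
        · rw [Finset.card_insert_of_notMem (by simp [hxY]), Finset.card_erase_of_mem hx']
          have := Finset.card_pos.2 ⟨x', hx'⟩
          omega
        · rw [← hYi, Finset.image_insert, ← hxx', ← Finset.image_insert, Finset.insert_erase hx']
  rw [hset, Finset.card_pair]
  · exact even_two
  · intro h
    exact hxY (h ▸ Finset.mem_insert_self _ _)

/-- Scarf's lemma. The points `s i` are the slack points. -/
theorem exists_colorful_dominant [Fintype X] [Nonempty I] {f : I → X → ℕ}
    (hf : ∀ i, Function.Injective (f i)) (s : I → X) (hleast : ∀ i y, f i (s i) ≤ f i y)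
    (hlarge : ∀ i j y, i ≠ j → y ∉ Set.range s → f i y < f i (s j)) (c : X → I)
    (hc : ∀ i, c (s i) = i) (hne : ∃ y, y ∉ Set.range s) :
    ∃ R : Finset X, Dominant f R ∧ R.image c = Finset.univ := by
  classical
  by_contra hcon
  push Not at hcon
  obtain ⟨i₀⟩ := ‹Nonempty I›
  have hsinj : Function.Injective s := fun i j h => by rw [← hc i, h, hc]
  set rooms : Finset (Finset X) :=
    Finset.univ.filter fun R => R.card = Fintype.card I ∧ Dominant f R
  set doors : Finset (Finset X) := Finset.univ.filter fun Y =>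
    (Y.card + 1 = Fintype.card I ∧ Y.image c = Finset.univ.erase i₀) ∧ Dominant f Y
  -- Parity argument: incidences between rooms and doors are counted twice. Without a colourful room
  -- the count by rooms is even. The count by doors is odd, since the door `Y₀` of slack points lies
  -- in one room and every other door in two.
  have hdc := Finset.sum_card_bipartiteAbove_eq_sum_card_bipartiteBelow
    (s := rooms) (t := doors) (fun R Y => Y ⊆ R)
  have heven : Even (∑ R ∈ rooms, (doors.bipartiteAbove (fun R Y => Y ⊆ R) R).card) := by
    refine Finset.even_sum _ fun R hR => ?_
    simp only [rooms, Finset.mem_filter, Finset.mem_univ, true_and] at hR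
    refine even_card_doors hR.1 (hcon R hR.2) i₀ fun Y hY => ?_
    simp only [doors, Finset.mem_filter, Finset.mem_univ, true_and, and_iff_left_iff_imp]
    exact fun _ => hR.2.mono hY
  have hroom : ∀ Y ∈ doors, ∀ R, (R ∈ rooms ∧ Y ⊆ R) ↔
      ∃ x, x ∉ Y ∧ insert x Y = R ∧ Dominant f (insert x Y) := by
    intro Y hY R
    simp only [doors, rooms, Finset.mem_filter, Finset.mem_univ, true_and] at hY ⊢
    constructor
    · rintro ⟨⟨h1, h2⟩, h3⟩
      obtain ⟨x, hx, rfl⟩ := Finset.exists_eq_insert_iff.2 ⟨h3, hY.1.1.trans h1.symm⟩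
      exact ⟨x, hx, rfl, h2⟩
    · rintro ⟨x, hx, rfl, h⟩
      exact ⟨⟨by rw [Finset.card_insert_of_notMem hx]; exact hY.1.1, h⟩, Finset.subset_insert _ _⟩
  set Y₀ : Finset X := (Finset.univ.erase i₀).image s
  have hmemY₀ : ∀ j, j ≠ i₀ → s j ∈ Y₀ := fun j hj =>
    Finset.mem_image_of_mem _ (by simpa using hj)
  obtain ⟨x₀, hx₀, hx₀max⟩ := Finset.exists_max_image
    (Finset.univ.filter fun y => y ∉ Set.range s) (f i₀) (by
      obtain ⟨y, hy⟩ := hne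
      exact ⟨y, by simpa using hy⟩)
  simp only [Finset.mem_filter, Finset.mem_univ, true_and] at hx₀ hx₀max
  have hx₀Y : x₀ ∉ Y₀ := by
    intro h
    obtain ⟨j, -, hj⟩ := Finset.mem_image.1 h
    exact hx₀ ⟨j, hj⟩
  have hdom₀ : ∀ x, x ∉ Y₀ → (Dominant f (insert x Y₀) ↔ x = x₀) := by
    intro x hx
    constructor
    · intro h
      have hle : ∀ y, y ∉ Set.range s → f i₀ y ≤ f i₀ x := by
        intro y hy
        obtain ⟨i, hi⟩ := h y
        by_cases hii : i = i₀
        · subst hii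
          exact hi x (by simp)
        · exact absurd ⟨i, hf i (le_antisymm (hleast i y)
            (hi (s i) (Finset.mem_insert_of_mem (hmemY₀ i hii))))⟩ hy
      have hxr : x ∉ Set.range s := by
        rintro ⟨j, rfl⟩
        by_cases hj : j = i₀
        · subst hj
          exact hx₀ ⟨j, hf j (le_antisymm (hleast j _) (hle x₀ hx₀))⟩
        · exact hx (hmemY₀ j hj)
      exact hf i₀ (le_antisymm (hx₀max x hxr) (hle x₀ hx₀))
    · rintro rfl y
      by_cases hy : y ∈ Set.range s
      · obtain ⟨j, rfl⟩ := hy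
        exact ⟨j, fun z _ => hleast j z⟩
      · refine ⟨i₀, fun z hz => ?_⟩
        rcases Finset.mem_insert.1 hz with rfl | hz
        · exact hx₀max y hy
        · obtain ⟨j, hj, rfl⟩ := Finset.mem_image.1 hz
          exact (hlarge i₀ j y (Finset.ne_of_mem_erase hj).symm hy).le
  have hY₀ : Y₀ ∈ doors := by
    simp only [doors, Finset.mem_filter, Finset.mem_univ, true_and]
    refine ⟨⟨?_, ?_⟩, ((hdom₀ x₀ hx₀Y).2 rfl).mono (Finset.subset_insert _ _)⟩
    · rw [Finset.card_image_of_injective _ hsinj, Finset.card_erase_of_mem (Finset.mem_univ _),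
        Finset.card_univ]
      have := Fintype.card_pos_iff.2 ⟨i₀⟩
      omega
    · rw [Finset.image_image]
      simp [Function.comp_def, hc]
  have hone : (rooms.bipartiteBelow (fun R Y => Y ⊆ R) Y₀).card = 1 := by
    rw [Finset.card_eq_one]
    refine ⟨insert x₀ Y₀, ?_⟩
    ext R
    rw [Finset.mem_bipartiteBelow, hroom _ hY₀, Finset.mem_singleton]
    constructor
    · rintro ⟨x, hx, rfl, h⟩
      rw [(hdom₀ x hx).1 h]
    · rintro rfl
      exact ⟨x₀, hx₀Y, rfl, (hdom₀ x₀ hx₀Y).2 rfl⟩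
  have htwo : ∀ Y ∈ doors.erase Y₀, Even (rooms.bipartiteBelow (fun R Y => Y ⊆ R) Y).card := by
    intro Y hY
    obtain ⟨hYne, hYD⟩ := Finset.mem_erase.1 hY
    have hYD' := hYD
    simp only [doors, Finset.mem_filter, Finset.mem_univ, true_and] at hYD'
    obtain ⟨⟨hcard, himg⟩, hdom⟩ := hYD'
    -- A door of slack points only is determined by its colours, so it is `Y₀`. Otherwise, relative
    -- to a non-slack point `t`, the slack points provide the upper points required by
    -- `exists_two_rooms`.
    have hex : ∃ t ∈ Y, t ∉ Set.range s := by
      by_contra! hall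
      apply hYne
      symm
      apply Finset.eq_of_subset_of_card_le
      · intro z hz
        obtain ⟨i, hi, rfl⟩ := Finset.mem_image.1 hz
        rw [← himg] at hi
        obtain ⟨y, hy, rfl⟩ := Finset.mem_image.1 hi
        obtain ⟨j, rfl⟩ := hall y hy
        rwa [hc]
      · rw [Finset.card_image_of_injective _ hsinj, Finset.card_erase_of_mem (Finset.mem_univ _),
          Finset.card_univ]
        omega
    obtain ⟨t, htY, ht⟩ := hex
    obtain ⟨x₁, x₂, h1, h2, h12, hiff⟩ := hdom.exists_two_rooms hf hcard ⟨t, htY⟩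
      (fun j => ⟨s j, fun i hi => ⟨t, htY, hlarge i j t hi ht⟩⟩)
    have : rooms.bipartiteBelow (fun R Y => Y ⊆ R) Y = {insert x₁ Y, insert x₂ Y} := by
      ext R
      rw [Finset.mem_bipartiteBelow, hroom _ hYD, Finset.mem_insert, Finset.mem_singleton]
      constructor
      · rintro ⟨x, hx, rfl, h⟩
        rcases (hiff x hx).1 h with rfl | rfl <;> simp
      · rintro (rfl | rfl)
        · exact ⟨x₁, h1, rfl, (hiff _ h1).2 (.inl rfl)⟩
        · exact ⟨x₂, h2, rfl, (hiff _ h2).2 (.inr rfl)⟩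
    rw [this, Finset.card_pair]
    · exact even_two
    · intro h
      have : x₁ ∈ insert x₂ Y := h ▸ Finset.mem_insert_self _ _
      simp [h12, h1] at this
  rw [hdc, ← Finset.add_sum_erase _ _ hY₀, hone] at heven
  have := Finset.even_sum _ htwo
  rw [Nat.even_add] at heven
  exact absurd (heven.2 this) (by decide)

end Scarf

/-! ### Brouwer's fixed point theorem for the standard simplex -/

section Brouwer

variable {I : Type*} [Fintype I] [DecidableEq I]

/-- A two-digit number in base `M` is compared by its leading digit; this lets a numbering of the
points break ties between equal weights. -/
lemma mul_add_lt_mul_add {M a b e e' : ℕ} (he : e < M) (hab : a < b) :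
    a * M + e < b * M + e' := by
  have : (a + 1) * M ≤ b * M := Nat.mul_le_mul_right _ hab
  rw [Nat.add_mul, Nat.one_mul] at this
  omega

/-- For every colouring of the grid points of a simplex there is a small cell that contains all the
colours, but for coordinates that are small on it. -/
theorem exists_colorful_cell [Nonempty I] (N : ℕ) (c : (I → ℕ) → I) :
    ∃ z : I → ℕ, ∑ i, z i = N ∧ ∀ i, ∃ w : I → ℕ, ∑ l, w l = N ∧
      (∀ l, w l ≤ z l + Fintype.card I) ∧ (∀ l, z l ≤ w l + Fintype.card I) ∧
      (c w = i ∨ w i ≤ Fintype.card I) := by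
  classical
  let T := {x : I → ℕ // x ∈ Finset.piAntidiag Finset.univ N}
  have : Fintype T := FinsetCoe.fintype _
  have hT : ∀ x : I → ℕ, ∑ i, x i = N → x ∈ Finset.piAntidiag Finset.univ N := by
    intro x hx
    simpa [Finset.mem_piAntidiag] using hx
  have hT' : ∀ x : T, ∑ i, x.1 i = N := fun x => (Finset.mem_piAntidiag.1 x.2).1
  have hle : ∀ (x : T) i, x.1 i ≤ N := fun x i =>
    (Finset.single_le_sum (f := x.1) (fun _ _ => Nat.zero_le _) (Finset.mem_univ i)).trans_eq (hT' x)
  -- Grid points get weights between `1` and `N + 1` in every order. The value `0` puts the slack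
  -- point of an order below them, and `N + 2` puts the other slack points above.
  let weight : I → I ⊕ T → ℕ := fun i =>
    Sum.elim (fun j => if i = j then 0 else N + 2) (fun x => x.1 i + 1)
  let e := Fintype.equivFin (I ⊕ T)
  let f : I → I ⊕ T → ℕ := fun i y => weight i y * Fintype.card (I ⊕ T) + (e y : ℕ)
  have hf : ∀ i, Function.Injective (f i) := by
    intro i x y hxy
    have h : (f i x) % Fintype.card (I ⊕ T) = (f i y) % Fintype.card (I ⊕ T) := by rw [hxy]
    simp only [f, Nat.mul_add_mod_self_right, Nat.mod_eq_of_lt (e x).2,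
      Nat.mod_eq_of_lt (e y).2] at h
    exact e.injective (Fin.ext h)
  have hlt : ∀ i x y, weight i x < weight i y → f i x < f i y := fun i x y h =>
    mul_add_lt_mul_add (e x).2 h
  have hwle : ∀ i x y, f i x ≤ f i y → weight i x ≤ weight i y := by
    intro i x y h
    by_contra hcon
    have := hlt i y x (by omega)
    omega
  have hnr : ∀ x : T, (Sum.inr x : I ⊕ T) ∉ Set.range (Sum.inl : I → I ⊕ T) := by
    rintro x ⟨j, hj⟩
    exact absurd hj (by simp)
  obtain ⟨i₁⟩ := id ‹Nonempty I›
  obtain ⟨R, hdom, hcol⟩ := exists_colorful_dominant hf Sum.inl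
    (by
      intro i y
      by_cases hy : y = Sum.inl i
      · rw [hy]
      · refine (hlt i _ _ ?_).le
        rcases y with j | x
        · have : i ≠ j := fun h => hy (by rw [h])
          simp [weight, this]
        · simp [weight])
    (by
      intro i j y hij hy
      rcases y with l | x
      · exact absurd ⟨l, rfl⟩ hy
      · apply hlt
        have := hle x i
        simp only [weight, Sum.elim_inr, Sum.elim_inl, if_neg hij]
        omega)
    (Sum.elim id fun x => c x.1) (fun i => rfl)
    ⟨Sum.inr ⟨Pi.single i₁ N, hT _ (by simp)⟩, hnr _⟩
  set C : Finset I := Finset.univ.filter fun i => Sum.inl i ∉ R with hC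
  have hslack : ∀ (y : T) i, (∀ r ∈ R, f i (Sum.inr y) ≤ f i r) → i ∈ C := by
    intro y i hi
    simp only [hC, Finset.mem_filter, Finset.mem_univ, true_and]
    intro hmem
    have := hwle _ _ _ (hi _ hmem)
    simp [weight] at this
  have hcolor : ∀ i ∈ C, ∃ w : T, Sum.inr w ∈ R ∧ c w.1 = i := by
    intro i hi
    simp only [hC, Finset.mem_filter, Finset.mem_univ, true_and] at hi
    have : i ∈ R.image (Sum.elim id fun x : T => c x.1) := by
      rw [hcol]
      exact Finset.mem_univ i
    obtain ⟨r, hr, hri⟩ := Finset.mem_image.1 this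
    rcases r with j | w
    · simp only [Sum.elim_inl, id] at hri
      exact absurd (hri ▸ hr) hi
    · exact ⟨w, hr, hri⟩
  obtain ⟨i₀, hi₀⟩ : ∃ i₀, i₀ ∈ C := by
    obtain ⟨i, hi⟩ := hdom (Sum.inr ⟨Pi.single i₁ N, hT _ (by simp)⟩)
    exact ⟨i, hslack _ i hi⟩
  obtain ⟨z, hzR, -⟩ := hcolor i₀ hi₀
  have hmin : ∀ i, ∃ w : T, Sum.inr w ∈ R ∧ ∀ x : T, Sum.inr x ∈ R → w.1 i ≤ x.1 i := by
    intro i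
    obtain ⟨w, hw, hw'⟩ := Finset.exists_min_image
      (Finset.univ.filter fun x : T => Sum.inr x ∈ R) (fun x => x.1 i) ⟨z, by simpa using hzR⟩
    simp only [Finset.mem_filter, Finset.mem_univ, true_and] at hw hw'
    exact ⟨w, hw, hw'⟩
  choose μ hμR hμ using hmin
  -- Otherwise raising every minimum over `C` by one, and giving the rest of `N` to `i₀`, produces a
  -- grid point that violates dominance. So the minima over `C` nearly exhaust `N`, leaving each
  -- coordinate a range of at most the number of indices.
  have hsum : N < ∑ i ∈ C, ((μ i).1 i + 1) := by
    by_contra! hcon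
    let y : I → ℕ := fun i => (if i ∈ C then (μ i).1 i + 1 else 0) +
      if i = i₀ then N - ∑ i ∈ C, ((μ i).1 i + 1) else 0
    have hy : ∑ i, y i = N := by
      simp only [y, Finset.sum_add_distrib, Finset.sum_ite_eq', Finset.mem_univ, if_true,
        Finset.sum_ite_mem, Finset.univ_inter]
      rw [← Finset.sum_add_distrib]
      omega
    obtain ⟨i, hi⟩ := hdom (Sum.inr ⟨y, hT y hy⟩)
    have hiC := hslack _ i hi
    have := hwle _ _ _ (hi _ (hμR i))
    simp only [weight, Sum.elim_inr, y, if_pos hiC] at this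
    omega
  rw [Finset.sum_add_distrib, Finset.sum_const, smul_eq_mul, mul_one] at hsum
  have hCcard : C.card ≤ Fintype.card I := Finset.card_le_univ C
  have hin : ∀ x : T, Sum.inr x ∈ R → ∀ i ∈ C,
      (μ i).1 i ≤ x.1 i ∧ x.1 i ≤ (μ i).1 i + Fintype.card I := by
    intro x hx i hi
    refine ⟨hμ i x hx, ?_⟩
    have h1 := Finset.add_sum_erase C (fun i => (μ i).1 i) hi
    have h2 := Finset.add_sum_erase C (fun i => x.1 i) hi
    have h3 : ∑ l ∈ C.erase i, (μ l).1 l ≤ ∑ l ∈ C.erase i, x.1 l :=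
      Finset.sum_le_sum fun l _ => hμ l x hx
    have h4 : ∑ l ∈ C, x.1 l ≤ N :=
      (Finset.sum_le_univ_sum_of_nonneg fun _ => Nat.zero_le _).trans_eq (hT' x)
    omega
  have hout : ∀ x : T, Sum.inr x ∈ R → ∀ i, i ∉ C → x.1 i ≤ Fintype.card I := by
    intro x hx i hi
    have h1 := Finset.sum_insert (f := x.1) hi
    have h3 : ∑ l ∈ C, (μ l).1 l ≤ ∑ l ∈ C, x.1 l := Finset.sum_le_sum fun l _ => hμ l x hx
    have h4 : ∑ l ∈ insert i C, x.1 l ≤ N :=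
      (Finset.sum_le_univ_sum_of_nonneg fun _ => Nat.zero_le _).trans_eq (hT' x)
    omega
  have hclose : ∀ x y : T, Sum.inr x ∈ R → Sum.inr y ∈ R → ∀ i,
      x.1 i ≤ y.1 i + Fintype.card I := by
    intro x y hx hy i
    by_cases hi : i ∈ C
    · have := hin x hx i hi
      have := hin y hy i hi
      omega
    · have := hout x hx i hi
      omega
  refine ⟨z.1, hT' z, fun i => ?_⟩
  by_cases hi : i ∈ C
  · obtain ⟨w, hw, hwi⟩ := hcolor i hi
    exact ⟨w.1, hT' w, hclose w z hw hzR, hclose z w hzR hw, .inl hwi⟩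
  · exact ⟨z.1, hT' z, hclose z z hzR hzR, hclose z z hzR hzR, .inr (hout z hzR i hi)⟩

/-- **Brouwer's fixed point theorem** for the standard simplex. -/
theorem exists_fixedPoint_stdSimplex [Nonempty I] {g : (I → ℝ) → I → ℝ}
    (hg : ContinuousOn g (stdSimplex ℝ I)) (hmaps : Set.MapsTo g (stdSimplex ℝ I) (stdSimplex ℝ I)) :
    ∃ x ∈ stdSimplex ℝ I, g x = x := by
  let scale : ℕ → (I → ℕ) → I → ℝ := fun N x i => (x i : ℝ) / (N + 1 : ℕ)
  have hscale : ∀ N (x : I → ℕ), ∑ i, x i = N + 1 → scale N x ∈ stdSimplex ℝ I := by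
    intro N x hx
    refine ⟨fun i => by positivity, ?_⟩
    simp only [scale]
    rw [← Finset.sum_div, ← Nat.cast_sum, hx, div_self (by positivity)]
  -- A point is coloured by a coordinate that `g` does not decrease; one exists since both
  -- coordinate sums are `1`. In the limit of ever smaller cells no coordinate is decreased, which
  -- forces equality.
  have hcol : ∀ N (x : I → ℕ), ∃ i, ∑ i, x i = N + 1 → scale N x i ≤ g (scale N x) i := by
    intro N x
    by_cases hx : ∑ i, x i = N + 1
    · by_contra! hcon
      have hlt : ∑ i, g (scale N x) i < ∑ i, scale N x i :=
        Finset.sum_lt_sum_of_nonempty Finset.univ_nonempty fun i _ => (hcon i).2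
      rw [(hmaps (hscale N x hx)).2, (hscale N x hx).2] at hlt
      exact lt_irrefl _ hlt
    · exact ⟨Classical.arbitrary I, fun h => absurd h hx⟩
  choose c hc using hcol
  choose z hz w hw hwz hzw hcw using fun N => exists_colorful_cell (N + 1) (c N)
  obtain ⟨x, hx, φ, hφ, hlim⟩ := (isCompact_stdSimplex ℝ I).tendsto_subseq
    fun N => hscale N (z N) (hz N)
  have hzero : Tendsto (fun N => (Fintype.card I : ℝ) / (φ N + 1 : ℕ)) atTop (nhds 0) := by
    refine Tendsto.comp (g := fun n : ℕ => (Fintype.card I : ℝ) / n)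
      (tendsto_const_div_atTop_nhds_zero_nat _) ?_
    exact (tendsto_add_atTop_nat 1).comp hφ.tendsto_atTop
  have hwlim : ∀ i, Tendsto (fun N => scale (φ N) (w (φ N) i)) atTop (nhds x) := by
    intro i
    rw [tendsto_pi_nhds] at hlim ⊢
    intro l
    have h0 : Tendsto (fun N => scale (φ N) (w (φ N) i) l - scale (φ N) (z (φ N)) l) atTop
        (nhds 0) := by
      refine squeeze_zero_norm (fun N => ?_) hzero
      have h1 : ((w (φ N) i l : ℕ) : ℝ) ≤ z (φ N) l + Fintype.card I := by
        exact_mod_cast hwz (φ N) i l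
      have h2 : ((z (φ N) l : ℕ) : ℝ) ≤ w (φ N) i l + Fintype.card I := by
        exact_mod_cast hzw (φ N) i l
      simp only [scale]
      rw [← sub_div, Real.norm_eq_abs, abs_div, Nat.abs_cast]
      gcongr
      exact abs_le.2 ⟨by linarith, by linarith⟩
    simpa using h0.add (hlim l)
  have hle : ∀ i, x i ≤ g x i := by
    intro i
    have hgw : Tendsto (fun N => g (scale (φ N) (w (φ N) i))) atTop (nhds (g x)) :=
      (hg x hx).tendsto.comp (tendsto_nhdsWithin_iff.2
        ⟨hwlim i, Eventually.of_forall fun N => hscale _ _ (hw _ _)⟩)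
    have h1 := ((tendsto_pi_nhds.1 hgw) i).add hzero
    rw [add_zero] at h1
    refine le_of_tendsto_of_tendsto' ((tendsto_pi_nhds.1 (hwlim i)) i) h1 fun N => ?_
    rcases hcw (φ N) i with h | h
    · have := hc (φ N) (w (φ N) i) (hw _ _)
      rw [h] at this
      have h0 : 0 ≤ (Fintype.card I : ℝ) / (φ N + 1 : ℕ) := by positivity
      linarith
    · have h0 := (hmaps (hscale _ _ (hw (φ N) i))).1 i
      have h2 : scale (φ N) (w (φ N) i) i ≤ (Fintype.card I : ℝ) / (φ N + 1 : ℕ) := by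
        simp only [scale]
        gcongr
      linarith
  refine ⟨x, hx, ?_⟩
  have hsum : ∑ i, (g x i - x i) = 0 := by
    rw [Finset.sum_sub_distrib, (hmaps hx).2, hx.2, sub_self]
  rw [Finset.sum_eq_zero_iff_of_nonneg fun i _ => sub_nonneg.2 (hle i)] at hsum
  funext i
  linarith [hsum i (Finset.mem_univ i)]

end Brouwer

/-! ### Mixed strategies and the existence of Nash equilibria -/

/-- The first-moment principle: some outcome is no larger than the mean. It picks the samples below,
and strategies with nonnegative gain in Nash's theorem. -/
lemma exists_le_of_mem_stdSimplex {S : Type*} [Fintype S] {p : S → ℝ} (hp : p ∈ stdSimplex ℝ S)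
    {φ : S → ℝ} {B : ℝ} (h : ∑ s, p s * φ s ≤ B) : ∃ s, φ s ≤ B := by
  by_contra! hcon
  have h1 : ∑ s, p s * (φ s - B) ≤ 0 := by
    simp only [mul_sub, Finset.sum_sub_distrib, ← Finset.sum_mul, hp.2]
    linarith
  have h2 := (Finset.sum_eq_zero_iff_of_nonneg fun s _ =>
    mul_nonneg (hp.1 s) (sub_nonneg.2 (hcon s).le)).1 (le_antisymm h1 (Finset.sum_nonneg
      fun s _ => mul_nonneg (hp.1 s) (sub_nonneg.2 (hcon s).le)))
  have h3 : ∑ s, p s = 0 := Finset.sum_eq_zero fun s hs =>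
    (mul_eq_zero.1 (h2 s hs)).resolve_right (sub_pos.2 (hcon s)).ne'
  rw [hp.2] at h3
  exact one_ne_zero h3

section MixedStrategies

variable {ι : Type*} [DecidableEq ι] {S : ι → Type*} [∀ i, Fintype (S i)]

lemma update_mem_stdSimplex {σ : ∀ i, S i → ℝ} (hσ : ∀ i, σ i ∈ stdSimplex ℝ (S i)) {i : ι}
    {τ : S i → ℝ} (hτ : τ ∈ stdSimplex ℝ (S i)) (l : ι) :
    Function.update σ i τ l ∈ stdSimplex ℝ (S l) := by
  by_cases h : l = i
  · subst h
    rwa [Function.update_self]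
  · rw [Function.update_of_ne h]
    exact hσ l

variable [Fintype ι]

/-- The expectation of `f` if the coordinates are independent with distributions `σ i`. -/
def prodExpect (σ : ∀ i, S i → ℝ) (f : (∀ i, S i) → ℝ) : ℝ :=
  ∑ s : ∀ i, S i, (∏ i, σ i (s i)) * f s

lemma prodExpect_sub (σ : ∀ i, S i → ℝ) (f g : (∀ i, S i) → ℝ) :
    prodExpect σ (fun s => f s - g s) = prodExpect σ f - prodExpect σ g := by
  simp [prodExpect, mul_sub, Finset.sum_sub_distrib]

lemma prodExpect_div (σ : ∀ i, S i → ℝ) (f : (∀ i, S i) → ℝ) (c : ℝ) :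
    prodExpect σ (fun s => f s / c) = prodExpect σ f / c := by
  simp only [prodExpect, Finset.sum_div, mul_div_assoc]

lemma prodExpect_sum {κ : Type*} (t : Finset κ) (σ : ∀ i, S i → ℝ) (f : κ → (∀ i, S i) → ℝ) :
    prodExpect σ (fun s => ∑ l ∈ t, f l s) = ∑ l ∈ t, prodExpect σ (f l) := by
  simp only [prodExpect, Finset.mul_sum]
  exact Finset.sum_comm

lemma prodExpect_const {σ : ∀ i, S i → ℝ} (hσ : ∀ i, σ i ∈ stdSimplex ℝ (S i)) (c : ℝ) :
    prodExpect σ (fun _ => c) = c := by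
  have := Finset.prod_univ_sum (fun i => (Finset.univ : Finset (S i))) fun i j => σ i j
  simp only [(hσ _).2, Finset.prod_const_one, Fintype.piFinset_univ] at this
  rw [prodExpect, ← Finset.sum_mul, ← this, one_mul]

lemma prodExpect_mono {σ : ∀ i, S i → ℝ} (hσ : ∀ i, σ i ∈ stdSimplex ℝ (S i))
    {f g : (∀ i, S i) → ℝ} (h : ∀ s, f s ≤ g s) : prodExpect σ f ≤ prodExpect σ g :=
  Finset.sum_le_sum fun s _ =>
    mul_le_mul_of_nonneg_left (h s) (Finset.prod_nonneg fun i _ => (hσ i).1 _)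

lemma abs_prodExpect_le {σ : ∀ i, S i → ℝ} (hσ : ∀ i, σ i ∈ stdSimplex ℝ (S i))
    {f : (∀ i, S i) → ℝ} {B : ℝ} (h : ∀ s, |f s| ≤ B) : |prodExpect σ f| ≤ B := by
  have h1 := prodExpect_mono hσ fun s => (abs_le.1 (h s)).1
  have h2 := prodExpect_mono hσ fun s => (abs_le.1 (h s)).2
  rw [prodExpect_const hσ] at h1 h2
  exact abs_le.2 ⟨h1, h2⟩

lemma prodExpect_update (σ : ∀ i, S i → ℝ) (i : ι) (τ : S i → ℝ) (f : (∀ i, S i) → ℝ) :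
    prodExpect (Function.update σ i τ) f =
      ∑ s : ∀ i, S i, τ (s i) * ((∏ l ∈ Finset.univ.erase i, σ l (s l)) * f s) := by
  refine Finset.sum_congr rfl fun s _ => ?_
  rw [← Finset.mul_prod_erase _ _ (Finset.mem_univ i), Function.update_self, mul_assoc]
  congr 2
  exact Finset.prod_congr rfl fun l hl => by
    rw [Function.update_of_ne (Finset.ne_of_mem_erase hl)]

variable [∀ i, DecidableEq (S i)]

/-- The expectation is linear in every coordinate. -/
lemma prodExpect_update_eq_sum (σ : ∀ i, S i → ℝ) (i : ι) (τ : S i → ℝ) (f : (∀ i, S i) → ℝ) :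
    prodExpect (Function.update σ i τ) f =
      ∑ j, τ j * prodExpect (Function.update σ i (Pi.single j 1)) f := by
  simp only [prodExpect_update, Finset.mul_sum]
  rw [Finset.sum_comm]
  refine Finset.sum_congr rfl fun s _ => ?_
  rw [Finset.sum_eq_single (s i)]
  · simp
  · intro j _ hj
    simp [hj.symm]
  · simp

lemma prodExpect_eq_sum (σ : ∀ i, S i → ℝ) (i : ι) (f : (∀ i, S i) → ℝ) :
    prodExpect σ f = ∑ j, σ i j * prodExpect (Function.update σ i (Pi.single j 1)) f := by
  rw [← prodExpect_update_eq_sum, Function.update_eq_self]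

/-- Playing a pure strategy is the same as replacing the realized strategy. -/
lemma prodExpect_update_single {σ : ∀ i, S i → ℝ} (i : ι) (hσ : ∑ j, σ i j = 1)
    (j : S i) (f : (∀ i, S i) → ℝ) :
    prodExpect (Function.update σ i (Pi.single j 1)) f =
      prodExpect σ fun s => f (Function.update s i j) := by
  -- The integrand ignores coordinate `i`, so fixing that coordinate at any `l` gives the same
  -- expectation.
  have key : ∀ l, prodExpect (Function.update σ i (Pi.single l 1))
      (fun s => f (Function.update s i j)) =
      prodExpect (Function.update σ i (Pi.single j 1)) f := by
    intro l
    simp only [prodExpect_update, Pi.single_apply, ite_mul, one_mul, zero_mul]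
    rw [← Finset.sum_filter, ← Finset.sum_filter]
    refine Finset.sum_nbij' (fun s => Function.update s i j) (fun s => Function.update s i l)
      ?_ ?_ ?_ ?_ ?_
    · simp
    · simp
    · intro s hs
      simp only [Finset.mem_filter, Finset.mem_univ, true_and] at hs
      simp [← hs]
    · intro s hs
      simp only [Finset.mem_filter, Finset.mem_univ, true_and] at hs
      simp [← hs]
    · intro s _
      congr 1
      exact Finset.prod_congr rfl fun l hl => by
        rw [Function.update_of_ne (Finset.ne_of_mem_erase hl)]
  rw [prodExpect_eq_sum σ i fun s => f (Function.update s i j)]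
  simp only [key, ← Finset.sum_mul, hσ, one_mul]

/-- The distributions of the coordinates of a random profile. -/
def marginal (p : (∀ i, S i) → ℝ) (i : ι) (j : S i) : ℝ :=
  ∑ s : ∀ i, S i, if s i = j then p s else 0

lemma sum_marginal_mul (p : (∀ i, S i) → ℝ) (i : ι) (G : S i → ℝ) :
    ∑ j, marginal p i j * G j = ∑ s : ∀ i, S i, p s * G (s i) := by
  simp only [marginal, Finset.sum_mul, ite_mul, zero_mul]
  rw [Finset.sum_comm]
  simp

lemma marginal_mem_stdSimplex {p : (∀ i, S i) → ℝ} (hp : p ∈ stdSimplex ℝ (∀ i, S i)) (i : ι) :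
    marginal p i ∈ stdSimplex ℝ (S i) := by
  refine ⟨fun j => Finset.sum_nonneg fun s _ => ?_, ?_⟩
  · split_ifs
    exacts [hp.1 s, le_rfl]
  · have := sum_marginal_mul p i fun _ => 1
    simpa [hp.2] using this

/-- **Nash's theorem**: every finite game has an equilibrium in mixed strategies. -/
theorem exists_nash [∀ i, Nonempty (S i)] (u : ι → (∀ i, S i) → ℝ) :
    ∃ σ : ∀ i, S i → ℝ, (∀ i, σ i ∈ stdSimplex ℝ (S i)) ∧
      ∀ i j, prodExpect (Function.update σ i (Pi.single j 1)) (u i) ≤ prodExpect σ (u i) := by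
  -- `D` is the gain from a pure deviation when all play the marginals of `p`. Brouwer is applied to
  -- the single simplex of distributions over pure profiles, so no product of simplices is needed;
  -- `h` adds the gains of all the players.
  let D : ((∀ i, S i) → ℝ) → ∀ i, S i → ℝ := fun p i j =>
    prodExpect (Function.update (marginal p) i (Pi.single j 1)) (u i) -
      prodExpect (marginal p) (u i)
  let h : ((∀ i, S i) → ℝ) → (∀ i, S i) → ℝ := fun p s => ∑ i, D p i (s i)
  let H : ((∀ i, S i) → ℝ) → ℝ := fun p => ∑ s, max (h p s) 0
  have hD : ∀ p ∈ stdSimplex ℝ (∀ i, S i), ∀ i, ∑ j, marginal p i j * D p i j = 0 := by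
    intro p hp i
    simp only [D, mul_sub, Finset.sum_sub_distrib, ← Finset.sum_mul,
      (marginal_mem_stdSimplex hp i).2]
    rw [← prodExpect_eq_sum, one_mul, sub_self]
  have hmarg : Continuous (marginal : ((∀ i, S i) → ℝ) → ∀ i, S i → ℝ) := by
    refine continuous_pi fun i => continuous_pi fun j => ?_
    refine continuous_finsetSum _ fun s _ => ?_
    split_ifs <;> fun_prop
  have hexp : ∀ f : (∀ i, S i) → ℝ, Continuous fun σ : ∀ i, S i → ℝ => prodExpect σ f := by
    intro f
    unfold prodExpect
    fun_prop
  have hDc : ∀ i j, Continuous fun p => D p i j := fun i j =>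
    ((hexp _).comp (hmarg.update i continuous_const)).sub ((hexp _).comp hmarg)
  have hhc : ∀ s, Continuous fun p => h p s := fun s =>
    continuous_finsetSum _ fun i _ => hDc i (s i)
  have hH0 : ∀ p, 0 ≤ H p := fun p => Finset.sum_nonneg fun s _ => le_max_right _ _
  have hHc : Continuous H := continuous_finsetSum _ fun s _ => (hhc s).max continuous_const
  obtain ⟨p, hp, hfix⟩ := exists_fixedPoint_stdSimplex
    (g := fun p s => (p s + max (h p s) 0) / (1 + H p))
    (Continuous.continuousOn (continuous_pi fun s =>
      ((continuous_apply s).add ((hhc s).max continuous_const)).div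
        (continuous_const.add hHc) fun p => by linarith [hH0 p]))
    (by
      intro p hp
      refine ⟨fun s => div_nonneg (add_nonneg (hp.1 s) (le_max_right _ _)) (by linarith [hH0 p]),
        ?_⟩
      rw [← Finset.sum_div, Finset.sum_add_distrib, hp.2]
      exact div_self (by linarith [hH0 p]))
  have hph : ∑ s, p s * h p s = 0 := by
    simp only [h, Finset.mul_sum]
    rw [Finset.sum_comm]
    refine Finset.sum_eq_zero fun i _ => ?_
    rw [← sum_marginal_mul p i (D p i), hD p hp i]
  have hle : ∀ s, h p s ≤ 0 := by
    have h1 : ∀ s, p s * H p = max (h p s) 0 := by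
      intro s
      have := congrFun hfix s
      rw [div_eq_iff (by linarith [hH0 p])] at this
      linarith
    -- At the fixed point `p s * H p = max (h p s) 0`, and `h` has mean zero under `p`. Hence the
    -- positive part of `h` has zero sum of squares.
    have h2 : ∑ s, max (h p s) 0 * max (h p s) 0 = 0 := by
      calc ∑ s, max (h p s) 0 * max (h p s) 0 = ∑ s, (p s * h p s) * H p := by
            refine Finset.sum_congr rfl fun s _ => ?_
            have h3 : max (h p s) 0 * max (h p s) 0 = max (h p s) 0 * h p s := by
              rcases le_total (h p s) 0 with h | h
              · simp [max_eq_right h]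
              · simp [max_eq_left h]
            rw [h3, ← h1 s]
            ring
        _ = 0 := by rw [← Finset.sum_mul, hph, zero_mul]
    rw [Finset.sum_eq_zero_iff_of_nonneg fun s _ => mul_self_nonneg _] at h2
    intro s
    have := mul_self_eq_zero.1 (h2 s (Finset.mem_univ s))
    exact max_eq_right_iff.1 this
  refine ⟨marginal p, marginal_mem_stdSimplex hp, fun i j => sub_nonpos.1 ?_⟩
  -- Gains average to zero, so the other players can be given strategies of nonnegative gain; then
  -- `h ≤ 0` bounds the gain of player `i` alone.
  have hpos : ∀ l, ∃ q, 0 ≤ D p l q := by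
    intro l
    obtain ⟨q, hq⟩ := exists_le_of_mem_stdSimplex (marginal_mem_stdSimplex hp l)
      (φ := fun q => -D p l q) (B := 0) (by simp [hD p hp l])
    exact ⟨q, by linarith⟩
  choose q hq using hpos
  have := hle (Function.update q i j)
  simp only [h] at this
  rw [← Finset.add_sum_erase _ _ (Finset.mem_univ i), Function.update_self] at this
  have h4 : 0 ≤ ∑ l ∈ Finset.univ.erase i, D p l (Function.update q i j l) := by
    refine Finset.sum_nonneg fun l hl => ?_
    rw [Function.update_of_ne (Finset.ne_of_mem_erase hl)]
    exact hq l
  change D p i j ≤ 0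
  linarith

end MixedStrategies

/-! ### Sparse approximations of mixed strategies -/

section Sparse

/-- The uniform distribution on a sample (with multiplicities). -/
noncomputable def empirical {S : Type*} {N : ℕ} (x : Fin N → S) (j : S) : ℝ :=
  open Classical in ∑ n, if x n = j then (1 : ℝ) / N else 0

lemma sum_empirical_mul {S : Type*} [Fintype S] {N : ℕ} (x : Fin N → S) (φ : S → ℝ) :
    ∑ j, empirical x j * φ j = (∑ n, φ (x n)) / N := by
  classical
  simp only [empirical, Finset.sum_mul, ite_mul, zero_mul]
  rw [Finset.sum_comm, Finset.sum_div]
  refine Finset.sum_congr rfl fun n _ => ?_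
  simp
  ring

lemma empirical_mem_stdSimplex {S : Type*} [Fintype S] {N : ℕ} (hN : 0 < N) (x : Fin N → S) :
    empirical x ∈ stdSimplex ℝ S := by
  classical
  refine ⟨fun j => Finset.sum_nonneg fun n _ => ?_, ?_⟩
  · split_ifs <;> positivity
  · have := sum_empirical_mul x fun _ => 1
    have hN' : (N : ℝ) ≠ 0 := by positivity
    simpa [hN'] using this

/-- Samples can be chosen one by one such that an exponential potential grows slowly. -/
lemma exists_sample_potential {S A : Type*} [Fintype S] [Fintype A] {p : S → ℝ}
    (hp : p ∈ stdSimplex ℝ S) {G : A → S → ℝ} (hG : ∀ a s, |G a s| ≤ 2)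
    (hmean : ∀ a, ∑ s, p s * G a s = 0) {r : ℝ} (hr0 : 0 ≤ r) (hr : r ≤ 1 / 2) (N : ℕ) :
    ∃ x : Fin N → S, ∑ a, Real.exp (r * ∑ n, G a (x n)) ≤
      Fintype.card A * (1 + 4 * r ^ 2) ^ N := by
  induction N with
  | zero => exact ⟨Fin.elim0, by simp⟩
  | succ N ih =>
    obtain ⟨x, hx⟩ := ih
    -- Uses `exp y ≤ 1 + y + y ^ 2` for `|y| ≤ 1`; the linear term has mean zero.
    have hone : ∀ a, ∑ s, p s * Real.exp (r * G a s) ≤ 1 + 4 * r ^ 2 := by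
      intro a
      calc ∑ s, p s * Real.exp (r * G a s)
          ≤ ∑ s, p s * (1 + r * G a s + 4 * r ^ 2) := by
            refine Finset.sum_le_sum fun s _ => mul_le_mul_of_nonneg_left ?_ (hp.1 s)
            have h1 : |r * G a s| ≤ r * 2 := by
              rw [abs_mul, abs_of_nonneg hr0]
              exact mul_le_mul_of_nonneg_left (hG a s) hr0
            have h2 := (abs_le.1 (Real.abs_exp_sub_one_sub_id_le (h1.trans (by linarith)))).2
            have h3 : (r * G a s) ^ 2 ≤ (r * 2) ^ 2 := sq_le_sq' (abs_le.1 h1).1 (abs_le.1 h1).2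
            nlinarith
        _ = ∑ s, p s + r * ∑ s, p s * G a s + 4 * r ^ 2 * ∑ s, p s := by
            simp only [Finset.mul_sum, ← Finset.sum_add_distrib]
            exact Finset.sum_congr rfl fun s _ => by ring
        _ = 1 + 4 * r ^ 2 := by
            rw [hp.2, hmean a]
            ring
    obtain ⟨s, hs⟩ := exists_le_of_mem_stdSimplex hp
      (φ := fun s => ∑ a, Real.exp (r * ∑ n, G a (x n)) * Real.exp (r * G a s))
      (B := Fintype.card A * (1 + 4 * r ^ 2) ^ (N + 1)) (by
        calc ∑ s, p s * ∑ a, Real.exp (r * ∑ n, G a (x n)) * Real.exp (r * G a s)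
            = ∑ a, Real.exp (r * ∑ n, G a (x n)) * ∑ s, p s * Real.exp (r * G a s) := by
              simp only [Finset.mul_sum]
              rw [Finset.sum_comm]
              exact Finset.sum_congr rfl fun a _ => Finset.sum_congr rfl fun s _ => by ring
          _ ≤ ∑ a, Real.exp (r * ∑ n, G a (x n)) * (1 + 4 * r ^ 2) :=
              Finset.sum_le_sum fun a _ =>
                mul_le_mul_of_nonneg_left (hone a) (Real.exp_pos _).le
          _ ≤ Fintype.card A * (1 + 4 * r ^ 2) ^ (N + 1) := by
              rw [← Finset.sum_mul, pow_succ (1 + 4 * r ^ 2) N, ← mul_assoc]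
              exact mul_le_mul_of_nonneg_right hx (by positivity))
    refine ⟨Fin.cons s x, le_trans (le_of_eq ?_) hs⟩
    refine Finset.sum_congr rfl fun a _ => ?_
    rw [Fin.sum_univ_succ, ← Real.exp_add]
    simp only [Fin.cons_zero, Fin.cons_succ]
    congr 1
    ring

/-- A distribution is approximated from above, simultaneously for all the given test functions, by
the uniform distribution on a small sample. -/
lemma exists_empirical_le {S A : Type*} [Fintype S] [Fintype A] {p : S → ℝ}
    (hp : p ∈ stdSimplex ℝ S) {F : A → S → ℝ} (hF : ∀ a s, |F a s| ≤ 1) {t : ℝ} (ht0 : 0 < t)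
    (ht : t ≤ 1) {N : ℕ} (hN0 : 0 < N) (hN : 16 * Real.log (Fintype.card A) ≤ t ^ 2 * N) :
    ∃ x : Fin N → S, ∀ a, ∑ j, empirical x j * F a j ≤ ∑ j, p j * F a j + t := by
  have habs : ∀ a, |∑ j, p j * F a j| ≤ 1 := by
    intro a
    calc |∑ j, p j * F a j| ≤ ∑ j, |p j * F a j| := Finset.abs_sum_le_sum_abs _ _
      _ ≤ ∑ j, p j * 1 := Finset.sum_le_sum fun j _ => by
          rw [abs_mul, abs_of_nonneg (hp.1 j)]
          exact mul_le_mul_of_nonneg_left (hF a j) (hp.1 j)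
      _ = 1 := by simp [hp.2]
  obtain ⟨x, hx⟩ := exists_sample_potential hp (G := fun a s => F a s - ∑ j, p j * F a j)
    (fun a s => (abs_sub _ _).trans (by linarith [hF a s, habs a]))
    (fun a => by
      simp only [mul_sub, Finset.sum_sub_distrib, ← Finset.sum_mul, hp.2, one_mul, sub_self])
    -- With this rate a single potential term bounds `t / 8` times the total deviation by `log |A| +
    -- t ^ 2 * N / 16`. By `hN` this is at most `t ^ 2 * N / 8`, so the deviation is at most `t *
    -- N`.
    (r := t / 8) (by positivity) (by linarith) N
  refine ⟨x, fun a => ?_⟩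
  have hcard : (0 : ℝ) < Fintype.card A := by exact_mod_cast Fintype.card_pos_iff.2 ⟨a⟩
  have h1 : Real.exp (t / 8 * ∑ n, (F a (x n) - ∑ j, p j * F a j)) ≤
      Real.exp (Real.log (Fintype.card A) + N * (4 * (t / 8) ^ 2)) := by
    rw [Real.exp_add, Real.exp_log hcard, Real.exp_nat_mul]
    refine ((Finset.single_le_sum (f := fun a =>
      Real.exp (t / 8 * ∑ n, (F a (x n) - ∑ j, p j * F a j)))
      (fun _ _ => (Real.exp_pos _).le) (Finset.mem_univ a)).trans hx).trans ?_
    gcongr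
    linarith [Real.add_one_le_exp (4 * (t / 8) ^ 2)]
  rw [Real.exp_le_exp, Finset.sum_sub_distrib, Finset.sum_const, Finset.card_univ,
    Fintype.card_fin, nsmul_eq_mul] at h1
  have hN' : (0 : ℝ) < N := by exact_mod_cast hN0
  rw [sum_empirical_mul, div_le_iff₀ hN']
  have h2 : t * (∑ n, F a (x n) - N * ∑ j, p j * F a j) ≤ t * (t * N) := by nlinarith
  have h3 := le_of_mul_le_mul_left h2 ht0
  linarith

variable {ι : Type*} [Fintype ι] [DecidableEq ι] {S : ι → Type*} [∀ i, Fintype (S i)]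

/-- A profile of mixed strategies is approximated from above, simultaneously for all the given test
functions, by uniform distributions on small samples. -/
lemma exists_prod_empirical_le {A : Type*} [Fintype A] {σ : ∀ i, S i → ℝ}
    (hσ : ∀ i, σ i ∈ stdSimplex ℝ (S i)) {F : A → (∀ i, S i) → ℝ} (hF : ∀ a s, |F a s| ≤ 1)
    {t : ℝ} (ht0 : 0 < t) (ht : t ≤ 1) {N : ℕ} (hN0 : 0 < N)
    (hN : 16 * Real.log (Fintype.card A) ≤ t ^ 2 * N) :
    ∃ x : ∀ i, Fin N → S i, ∀ a, prodExpect (fun i => empirical (x i)) (F a) ≤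
      prodExpect σ (F a) + Fintype.card ι * t := by
  classical
  -- The coordinates are replaced one at a time. Each expectation is linear in the coordinate being
  -- replaced, so every replacement costs at most `t`.
  have key : ∀ J : Finset ι, ∃ τ : ∀ i, S i → ℝ, (∀ i, τ i ∈ stdSimplex ℝ (S i)) ∧
      (∀ i ∈ J, ∃ x : Fin N → S i, τ i = empirical x) ∧
      ∀ a, prodExpect τ (F a) ≤ prodExpect σ (F a) + J.card * t := by
    intro J
    induction J using Finset.induction_on with
    | empty => exact ⟨σ, hσ, by simp, by simp⟩
    | insert i J hi ih =>
      obtain ⟨τ, hτ, hemp, hle⟩ := ih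
      obtain ⟨x, hx⟩ := exists_empirical_le (hτ i)
        (F := fun a j => prodExpect (Function.update τ i (Pi.single j 1)) (F a))
        (fun a j => abs_prodExpect_le
          (update_mem_stdSimplex hτ (single_mem_stdSimplex ℝ j)) (hF a)) ht0 ht hN0 hN
      refine ⟨Function.update τ i (empirical x),
        update_mem_stdSimplex hτ (empirical_mem_stdSimplex hN0 x), ?_, ?_⟩
      · intro l hl
        by_cases hli : l = i
        · subst hli
          exact ⟨x, Function.update_self _ _ _⟩
        · rw [Function.update_of_ne hli]
          exact hemp l ((Finset.mem_insert.1 hl).resolve_left hli)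
      · intro a
        have h1 := hx a
        rw [← prodExpect_eq_sum, ← prodExpect_update_eq_sum] at h1
        have h2 := hle a
        rw [Finset.card_insert_of_notMem hi]
        push_cast
        linarith
  obtain ⟨τ, -, hemp, hle⟩ := key Finset.univ
  choose x hx using fun i => hemp i (Finset.mem_univ i)
  refine ⟨x, fun a => ?_⟩
  have : τ = fun i => empirical (x i) := funext hx
  rw [← this]
  simpa using hle a

/-- The expectation under uniform distributions on samples is an average over all combinations. -/
lemma prodExpect_empirical {N : ℕ} (x : ∀ i, Fin N → S i) (f : (∀ i, S i) → ℝ) :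
    prodExpect (fun i => empirical (x i)) f =
      (∑ n : ι → Fin N, f fun i => x i (n i)) / (N : ℝ) ^ Fintype.card ι := by
  classical
  have h1 : ∀ s : ∀ i, S i, ∏ i, empirical (x i) (s i) =
      ∑ n : ι → Fin N, if (fun i => x i (n i)) = s then (1 / (N : ℝ)) ^ Fintype.card ι else 0 := by
    intro s
    simp only [empirical]
    rw [Finset.prod_univ_sum, Fintype.piFinset_univ]
    refine Finset.sum_congr rfl fun n _ => ?_
    rw [Finset.prod_ite_zero]
    simp [funext_iff]
  simp only [prodExpect, h1, Finset.sum_mul, ite_mul, zero_mul]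
  rw [Finset.sum_comm, Finset.sum_div]
  refine Finset.sum_congr rfl fun n _ => ?_
  simp
  ring

end Sparse

/-! ### Protocols from auctions with a small price of anarchy -/

namespace CombAuction

section Protocol

variable {k m : ℕ}

lemma Auction.abs_utility_le (A : Auction k m) (v : Fin k → Valuation m) (i : Fin k)
    (s : ∀ i, A.Strategy i) : |A.utility v i s| ≤ A.payoffScale v i :=
  le_ciSup (f := fun s => |A.utility v i s|) (Set.finite_range _).bddAbove s

lemma Auction.payoffScale_nonneg (A : Auction k m) (v : Fin k → Valuation m) (i : Fin k) :
    0 ≤ A.payoffScale v i :=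
  Real.iSup_nonneg fun _ => abs_nonneg _

lemma Auction.IsApproxNash.mono {A : Auction k m} {v : Fin k → Valuation m} {ε ε' : ℝ}
    {σ : ∀ i, A.Strategy i → ℝ} (h : A.IsApproxNash v ε σ) (hε : ε ≤ ε') :
    A.IsApproxNash v ε' σ :=
  ⟨h.1, fun i τ hτ => (h.2 i τ hτ).trans
    (add_le_add_right (mul_le_mul_of_nonneg_right hε (A.payoffScale_nonneg v i)) _)⟩

/-- There are approximate Nash equilibria that are uniform on small samples. -/
theorem Auction.exists_sparse_approxNash (A : Auction k m) (v : Fin k → Valuation m)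
    {t : ℝ} (ht0 : 0 < t) (ht : t ≤ 1) {N : ℕ} (hN0 : 0 < N)
    (hN : 16 * Real.log (Fintype.card (Σ i, A.Strategy i)) ≤ t ^ 2 * N) :
    ∃ x : ∀ i, Fin N → A.Strategy i,
      A.IsApproxNash v (2 * k * t) fun i => empirical (x i) := by
  classical
  obtain ⟨σ, hσ, hnash⟩ := exists_nash (S := A.Strategy) (A.utility v)
  -- The test functions are the normalized regrets for pure deviations, one per strategy of each
  -- player. At a Nash equilibrium their means are nonpositive, so approximation from above
  -- suffices.
  have hF : ∀ (a : Σ i, A.Strategy i) (s : ∀ i, A.Strategy i),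
      |(A.utility v a.1 (Function.update s a.1 a.2) - A.utility v a.1 s) /
        (2 * A.payoffScale v a.1)| ≤ 1 := by
    rintro ⟨i, j⟩ s
    have h0 := A.payoffScale_nonneg v i
    rw [abs_div, abs_of_nonneg (by positivity : 0 ≤ 2 * A.payoffScale v i)]
    refine div_le_one_of_le₀ ((abs_sub _ _).trans ?_) (by positivity)
    linarith [A.abs_utility_le v i s, A.abs_utility_le v i (Function.update s i j)]
  obtain ⟨x, hx⟩ := exists_prod_empirical_le hσ hF ht0 ht hN0 hN
  have hemp : ∀ i, empirical (x i) ∈ stdSimplex ℝ (A.Strategy i) := fun i =>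
    empirical_mem_stdSimplex hN0 (x i)
  refine ⟨x, hemp, fun i τ hτ => ?_⟩
  set μ : ∀ i, A.Strategy i → ℝ := fun i => empirical (x i)
  have hpure : ∀ j, prodExpect (Function.update μ i (Pi.single j 1)) (A.utility v i) ≤
      prodExpect μ (A.utility v i) + 2 * k * t * A.payoffScale v i := by
    intro j
    have h1 := hx ⟨i, j⟩
    simp only [prodExpect_div, prodExpect_sub] at h1
    rw [← prodExpect_update_single i (hσ i).2, ← prodExpect_update_single i (hemp i).2,
      Fintype.card_fin] at h1
    have h2 := hnash i j
    have h0 := A.payoffScale_nonneg v i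
    -- At scale zero the normalized regret is `0` by convention and says nothing, but then all
    -- payoffs vanish.
    rcases h0.eq_or_lt with h | h
    · have h3 := abs_prodExpect_le (update_mem_stdSimplex hemp (single_mem_stdSimplex ℝ j))
        (A.abs_utility_le v i)
      have h4 := abs_prodExpect_le hemp (A.abs_utility_le v i)
      rw [← h] at h3 h4 ⊢
      linarith [(abs_le.1 h3).2, (abs_le.1 h4).1]
    · have h3 : (prodExpect (Function.update σ i (Pi.single j 1)) (A.utility v i) -
          prodExpect σ (A.utility v i)) / (2 * A.payoffScale v i) ≤ 0 :=
        div_nonpos_of_nonpos_of_nonneg (sub_nonpos.2 h2) (by positivity)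
      have h4 := h1.trans (add_le_add_left h3 _)
      rw [zero_add, div_le_iff₀ (by positivity)] at h4
      linarith
  change prodExpect (Function.update μ i τ) (A.utility v i) ≤
    prodExpect μ (A.utility v i) + 2 * k * t * A.payoffScale v i
  rw [prodExpect_update_eq_sum]
  calc ∑ j, τ j * prodExpect (Function.update μ i (Pi.single j 1)) (A.utility v i)
      ≤ ∑ j, τ j * (prodExpect μ (A.utility v i) + 2 * k * t * A.payoffScale v i) :=
        Finset.sum_le_sum fun j _ => mul_le_mul_of_nonneg_left (hpure j) (hτ.1 j)
    _ = _ := by rw [← Finset.sum_mul, hτ.2, one_mul]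

lemma Auction.expectedWelfare_eq_sum (A : Auction k m) (v : Fin k → Valuation m)
    (σ : ∀ i, A.Strategy i → ℝ) :
    A.expectedWelfare v σ =
      ∑ i, A.expect σ fun s => ((v i).val ((A.alloc s).bundle i) : ℝ) :=
  prodExpect_sum Finset.univ σ fun i s => ((v i).val ((A.alloc s).bundle i) : ℝ)

lemma Auction.le_poa (A : Auction k m) {v : Fin k → Valuation m} {ε W α : ℝ} (hW : 0 < W)
    (hα : 1 ≤ α) (hv : IsZeroInput W v) {σ : ∀ i, A.Strategy i → ℝ}
    (hσ : A.IsApproxNash v ε σ) (hwel : A.expectedWelfare v σ ≤ W / α) :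
    ENNReal.ofReal α ≤ A.poa ε v := by
  obtain ⟨T, hT⟩ := hv
  have hopt : W ≤ optWelfare v :=
    hT.trans (le_ciSup (f := welfare v) (Set.finite_range _).bddAbove T)
  refine le_trans ?_ (ENNReal.div_le_div_left (iInf_le _ ⟨σ, hσ⟩) _)
  rw [ENNReal.le_div_iff_mul_le (.inr (by simpa using hW.trans_le hopt))
    (.inr ENNReal.ofReal_ne_top), ← ENNReal.ofReal_mul (by linarith)]
  refine ENNReal.ofReal_le_ofReal (le_trans ?_ hopt)
  rw [le_div_iff₀ (by linarith)] at hwel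
  linarith

/-- Every bit string decodes to some certificate, so malformed proofs need no treatment. -/
lemma exists_surjective_of_card_le {C : Type*} [Fintype C] [Nonempty C] {c : ℕ}
    (h : Fintype.card C ≤ 2 ^ c) : ∃ dec : (Fin c → Bool) → C, Function.Surjective dec := by
  obtain ⟨e⟩ := Function.Embedding.nonempty_of_card_le (α := C) (β := Fin c → Bool) (by simpa)
  exact ⟨Function.invFun e, Function.invFun_surjective e.injective⟩

/-- If the price of anarchy is below `α`, then an equilibrium on small samples, together with the
players' expected values in it, is a certificate for the 1-inputs. -/
theorem Auction.exists_protocol (A : Auction k m) {V : Set (Valuation m)} {W α ε t : ℝ}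
    (hW : 0 < W) (hα : 1 ≤ α) {D N : ℕ} (hV : ∀ v ∈ V, ∀ T, v.val T ≤ 2 ^ D)
    (ht0 : 0 < t) (ht : t ≤ 1) (hε : 2 * k * t ≤ ε) (hN0 : 0 < N)
    (hN : 16 * Real.log (Fintype.card (Σ i, A.Strategy i)) ≤ t ^ 2 * N)
    (hpoa : A.worstCasePoA ε V < ENNReal.ofReal α) :
    ∃ P : NondetProtocol k m, P.Solves V W α ∧
      P.cost = k * (N * Nat.clog 2 A.numStrategies) + k * (k * N + D + 1) := by
  -- A certificate holds `N` samples per player and the numerator of each expected value over `N ^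
  -- k`, an integer of at most `N ^ k * 2 ^ D`.
  let C : Type := (∀ i, Fin N → A.Strategy i) × (Fin k → Fin (N ^ k * 2 ^ D + 1))
  have hcard : Fintype.card C ≤
      2 ^ (k * (N * Nat.clog 2 A.numStrategies) + k * (k * N + D + 1)) := by
    have h1 : ∀ i, Fintype.card (Fin N → A.Strategy i) ≤
        2 ^ (N * Nat.clog 2 A.numStrategies) := by
      intro i
      rw [Fintype.card_fun, Fintype.card_fin, mul_comm N, pow_mul]
      exact Nat.pow_le_pow_left ((Finset.le_sup (f := fun i => Fintype.card (A.Strategy i))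
        (Finset.mem_univ i)).trans (Nat.le_pow_clog one_lt_two _)) _
    have h2 : N ^ k * 2 ^ D + 1 ≤ 2 ^ (k * N + D + 1) := by
      have h3 : N ^ k ≤ 2 ^ (k * N) := by
        rw [mul_comm, pow_mul]
        exact Nat.pow_le_pow_left Nat.lt_two_pow_self.le _
      have h4 : 0 < 2 ^ (k * N + D) := by positivity
      rw [pow_succ]
      have h5 : N ^ k * 2 ^ D ≤ 2 ^ (k * N + D) := by
        rw [pow_add]
        exact Nat.mul_le_mul_right _ h3
      omega
    rw [Fintype.card_prod, Fintype.card_pi, Fintype.card_fun, Fintype.card_fin, Fintype.card_fin,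
      pow_add, mul_comm k (N * _), mul_comm k (k * N + D + 1), pow_mul, pow_mul 2 (k * N + D + 1)]
    refine Nat.mul_le_mul ?_ (Nat.pow_le_pow_left h2 _)
    refine (Finset.prod_le_pow_card _ _ _ fun i _ => h1 i).trans_eq ?_
    rw [Finset.card_univ, Fintype.card_fin]
  have : Nonempty C := ⟨fun i _ => Classical.arbitrary _, fun _ => 0⟩
  obtain ⟨dec, hdec⟩ := exists_surjective_of_card_le hcard
  -- Player `i` knows only `w`, so the valuation profile is filled with `w` everywhere; her utility
  -- and payoff scale do not see the other entries.
  refine ⟨⟨_, fun i b w =>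
    (∀ τ ∈ stdSimplex ℝ (A.Strategy i),
      A.expect (Function.update (fun l => empirical ((dec b).1 l)) i τ)
          (A.utility (fun _ => w) i) ≤
        A.expect (fun l => empirical ((dec b).1 l)) (A.utility (fun _ => w) i) +
          ε * A.payoffScale (fun _ => w) i) ∧
    A.expect (fun l => empirical ((dec b).1 l))
      (fun s => (w.val ((A.alloc s).bundle i) : ℝ)) = ((dec b).2 i : ℕ) / (N : ℝ) ^ k ∧
    ∑ l, (((dec b).2 l : ℕ) : ℝ) / (N : ℝ) ^ k ≤ W / α⟩, ?_, rfl⟩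
  intro v hv
  constructor
  · intro hone
    obtain ⟨x, hx⟩ := A.exists_sparse_approxNash v ht0 ht hN0 hN
    have hx' := hx.mono hε
    let c : Fin k → ℕ := fun i => ∑ n : Fin k → Fin N,
      (v i).val ((A.alloc fun i => x i (n i)).bundle i)
    have hc : ∀ i, c i < N ^ k * 2 ^ D + 1 := by
      intro i
      refine Nat.lt_succ_of_le ((Finset.sum_le_card_nsmul _ _ _ fun n _ => hV _ (hv i) _).trans_eq ?_)
      simp
    obtain ⟨b, hb⟩ := hdec (x, fun i => ⟨c i, hc i⟩)
    have hval : ∀ i, A.expect (fun l => empirical (x l))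
        (fun s => ((v i).val ((A.alloc s).bundle i) : ℝ)) = (c i : ℝ) / (N : ℝ) ^ k := by
      intro i
      have := prodExpect_empirical x fun s => ((v i).val ((A.alloc s).bundle i) : ℝ)
      rw [Fintype.card_fin] at this
      simp only [c, Nat.cast_sum]
      exact this
    refine ⟨b, fun i => ?_⟩
    simp only [hb]
    refine ⟨hx'.2 i, hval i, ?_⟩
    simp only [← hval]
    rw [← A.expectedWelfare_eq_sum v]
    exact (prodExpect_mono hx.1 fun s => hone (A.alloc s)).trans_eq (prodExpect_const hx.1 _)
  · rintro hzero ⟨b, hb⟩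
    simp only at hb
    have hnash : A.IsApproxNash v ε fun l => empirical ((dec b).1 l) :=
      ⟨fun i => empirical_mem_stdSimplex hN0 _, fun i => (hb i).1⟩
    refine absurd hpoa (not_lt.2 ?_)
    refine le_trans (A.le_poa hW hα hzero hnash ?_) (le_iSup (fun v : {v : Fin k → Valuation m //
      ∀ i, v i ∈ V} => A.poa ε v) ⟨v, hv⟩)
    rw [A.expectedWelfare_eq_sum]
    simp only [fun i => (hb i).2.1]
    -- Without players nobody checks the sum, but it is empty.
    rcases Nat.eq_zero_or_pos k with rfl | hk
    · simp only [Finset.univ_eq_empty, Finset.sum_empty]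
      exact div_nonneg hW.le (by linarith)
    · exact (hb ⟨0, hk⟩).2.2

/-- With `M = K + L ≥ 2`, the factor `64` is absorbed by `M ^ 6`, each of the four terms is at most
`M ^ (2 * d' + d + 11)`, and `4 ≤ M ^ 2`. -/
lemma protocol_cost_le {k K L N d d' : ℕ} (hk : k ≤ K) (hK : 2 ≤ K)
    (hN : N ≤ 64 * K ^ (2 * d' + 2) * (K + L)) :
    k * (N * L) + k * (k * N + K ^ d + 1) ≤ (K + L) ^ (2 * d' + d + 13) := by
  obtain ⟨M, hM⟩ : ∃ M, M = K + L := ⟨_, rfl⟩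
  rw [← hM] at hN ⊢
  have hM2 : 2 ≤ M := by omega
  have hM1 : 1 ≤ M := by omega
  have hkM : k ≤ M := by omega
  have hKM : K ≤ M := by omega
  have hLM : L ≤ M := by omega
  have h64 : 64 ≤ M ^ 6 := le_trans (by norm_num) (Nat.pow_le_pow_left hM2 6)
  have hNM : N ≤ M ^ (2 * d' + 9) := by
    calc N ≤ M ^ 6 * M ^ (2 * d' + 2) * M := hN.trans (by gcongr)
      _ = M ^ (2 * d' + 9) := by ring
  obtain ⟨B, hB⟩ : ∃ B, B = M ^ (2 * d' + d + 11) := ⟨_, rfl⟩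
  have hB' : ∀ n, n ≤ 2 * d' + d + 11 → M ^ n ≤ B := fun n hn =>
    hB ▸ Nat.pow_le_pow_right hM1 hn
  have h1 : k * (N * L) ≤ B := by
    calc k * (N * L) ≤ M * (M ^ (2 * d' + 9) * M) := by gcongr
      _ = M ^ (2 * d' + 11) := by ring
      _ ≤ B := hB' _ (by omega)
  have h2 : k * (k * N) ≤ B := by
    calc k * (k * N) ≤ M * (M * M ^ (2 * d' + 9)) := by gcongr
      _ = M ^ (2 * d' + 11) := by ring
      _ ≤ B := hB' _ (by omega)
  have h3 : k * K ^ d ≤ B := by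
    calc k * K ^ d ≤ M * M ^ d := by gcongr
      _ = M ^ (d + 1) := by ring
      _ ≤ B := hB' _ (by omega)
  have h4 : k ≤ B := hkM.trans ((pow_one M).ge.trans (hB' 1 (by omega)))
  have h5 : 4 * B ≤ M ^ (2 * d' + d + 13) := by
    rw [show 2 * d' + d + 13 = 2 + (2 * d' + d + 11) by omega, pow_add, ← hB]
    exact Nat.mul_le_mul_right _ (Nat.pow_le_pow_left hM2 2)
  rw [mul_add, mul_add, mul_one]
  omega

/-- The protocol's cost is polynomial in the number of players and of items and in the logarithm
of the number of strategies. -/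
theorem Auction.exists_protocol_cost_le (A : Auction k m) {V : Set (Valuation m)} {W α ε : ℝ}
    (hW : 0 < W) (hα : 1 ≤ α) {d d' : ℕ}
    (hV : ∀ v ∈ V, ∀ T, Nat.size (v.val T) ≤ (k + m + 2) ^ d)
    (hε : 1 / ((k + m + 2 : ℕ) : ℝ) ^ d' ≤ ε)
    (hpoa : A.worstCasePoA ε V < ENNReal.ofReal α) :
    ∃ P : NondetProtocol k m, P.Solves V W α ∧
      P.cost ≤ (k + m + 2 + Nat.clog 2 A.numStrategies) ^ (2 * d' + d + 13) := by
  set K := k + m + 2 with hK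
  set L := Nat.clog 2 A.numStrategies with hL
  have hK0 : (0 : ℝ) < K := by positivity
  have hK1 : (1 : ℝ) ≤ K := by
    rw [hK]
    push_cast
    linarith [Nat.cast_nonneg (α := ℝ) k, Nat.cast_nonneg (α := ℝ) m]
  have hkK : (k : ℝ) ≤ K := by
    rw [hK]
    push_cast
    linarith [Nat.cast_nonneg (α := ℝ) m]
  have hlog : Real.log (Fintype.card (Σ i, A.Strategy i)) ≤ K + L := by
    have hcard : Fintype.card (Σ i, A.Strategy i) ≤ 2 ^ (k + L) := by
      rw [Fintype.card_sigma, pow_add]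
      refine (Finset.sum_le_card_nsmul _ _ A.numStrategies fun i _ =>
        Finset.le_sup (f := fun i => Fintype.card (A.Strategy i)) (Finset.mem_univ i)).trans ?_
      rw [Finset.card_univ, Fintype.card_fin, smul_eq_mul]
      exact Nat.mul_le_mul Nat.lt_two_pow_self.le (Nat.le_pow_clog one_lt_two _)
    have hle : Real.log (Fintype.card (Σ i, A.Strategy i)) ≤ Real.log ((2 : ℝ) ^ (k + L)) := by
      rcases Nat.eq_zero_or_pos (Fintype.card (Σ i, A.Strategy i)) with h | h
      · rw [h, Nat.cast_zero, Real.log_zero]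
        exact Real.log_nonneg (one_le_pow₀ one_le_two)
      · exact Real.log_le_log (by exact_mod_cast h) (by exact_mod_cast hcard)
    rw [Real.log_pow] at hle
    push_cast at hle
    have : ((k : ℝ) + L) * Real.log 2 ≤ ((k : ℝ) + L) * 1 :=
      mul_le_mul_of_nonneg_left (by linarith [Real.log_two_lt_d9]) (by positivity)
    linarith
  obtain ⟨P, hP, hcost⟩ := A.exists_protocol (V := V) (W := W) (α := α) (ε := ε)
    -- This `t` gives `2 * k * t ≤ 1 / K ^ d' ≤ ε`, and `N` is chosen so that `t ^ 2 * N = 16 * (K +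
    -- L)`.
    (t := 1 / (2 * K ^ (d' + 1))) (D := K ^ d) (N := 64 * K ^ (2 * d' + 2) * (K + L)) hW hα
    (fun v hv T => (Nat.size_le.1 (hV v hv T)).le) (by positivity)
    (by
      rw [div_le_one (by positivity)]
      linarith [one_le_pow₀ hK1 (n := d' + 1)])
    (by
      refine le_trans ?_ hε
      rw [mul_one_div, div_le_div_iff₀ (by positivity) (by positivity), pow_succ]
      have : (k : ℝ) * (K : ℝ) ^ d' ≤ K * (K : ℝ) ^ d' :=
        mul_le_mul_of_nonneg_right hkK (by positivity)
      linarith)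
    (by positivity)
    (by
      have h1 : (1 / (2 * (K : ℝ) ^ (d' + 1))) ^ 2 * (64 * K ^ (2 * d' + 2) * (K + L) : ℕ) =
          16 * (K + L) := by
        push_cast
        field_simp
        ring
      rw [h1]
      linarith)
    hpoa
  refine ⟨P, hP, hcost.trans_le ?_⟩
  exact protocol_cost_le (by omega) (by omega) le_rfl

end Protocol

end CombAuction

/-! ### Growth rates -/

namespace CombAuction

section Growth

lemma GrowthConvention.tendsto_exponent (g : GrowthConvention) {δ : ℝ} (hδ : 0 < δ) :
    Tendsto (g.exponent δ) atTop atTop := by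
  cases g with
  | linear => exact tendsto_natCast_atTop_atTop.const_mul_atTop hδ
  | power => exact (tendsto_rpow_atTop hδ).comp tendsto_natCast_atTop_atTop

/-- Doubling the exponent is what a product of two bounds costs; this common property of both
conventions makes subexponential functions closed under sums, products and powers. -/
lemma GrowthConvention.exists_two_mul_exponent_le (g : GrowthConvention) {δ : ℝ} (hδ : 0 < δ) :
    ∃ δ', 0 < δ' ∧ ∀ᶠ m in atTop, 2 * g.exponent δ' m ≤ g.exponent δ m := by
  refine ⟨δ / 2, by positivity, ?_⟩
  cases g with
  | linear => exact Eventually.of_forall fun m => by simp only [exponent]; linarith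
  | power =>
    filter_upwards [(GrowthConvention.power.tendsto_exponent (half_pos hδ)).eventually_ge_atTop 2,
      eventually_gt_atTop 0] with m hm hm0
    simp only [exponent] at hm ⊢
    have h : (m : ℝ) ^ δ = (m : ℝ) ^ (δ / 2) * (m : ℝ) ^ (δ / 2) := by
      rw [← Real.rpow_add (by exact_mod_cast hm0), add_halves]
    rw [h]
    exact mul_le_mul_of_nonneg_right hm (by linarith)

lemma Subexponential.mono {g : GrowthConvention} {f h : ℕ → ℝ} (hf : Subexponential g f)
    (hle : ∀ᶠ m in atTop, h m ≤ f m) : Subexponential g h := fun δ hδ => by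
  filter_upwards [hf δ hδ, hle] with m h1 h2 using h2.trans h1

lemma subexponential_const (g : GrowthConvention) (c : ℝ) : Subexponential g fun _ => c :=
  fun _ hδ => ((tendsto_rpow_atTop_of_base_gt_one 2 one_lt_two).comp
    (g.tendsto_exponent hδ)).eventually_ge_atTop c

lemma subexponential_natCast (g : GrowthConvention) : Subexponential g fun m => (m : ℝ) := by
  intro δ hδ
  have hlog : ∀ᶠ m : ℕ in atTop, Real.log m ≤ Real.log 2 * g.exponent δ m := by
    have hc : 0 < Real.log 2 := Real.log_pos one_lt_two
    cases g with
    | linear =>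
      have := (Real.isLittleO_log_id_atTop.comp_tendsto
        (tendsto_natCast_atTop_atTop (R := ℝ))).bound (mul_pos hc hδ)
      filter_upwards [this] with m hm
      simp only [Function.comp_apply, id, Real.norm_eq_abs, Nat.abs_cast] at hm
      simp only [GrowthConvention.exponent]
      linarith [le_abs_self (Real.log m)]
    | power =>
      have := ((isLittleO_log_rpow_atTop hδ).comp_tendsto
        (tendsto_natCast_atTop_atTop (R := ℝ))).bound hc
      filter_upwards [this] with m hm
      simp only [Function.comp_apply, Real.norm_eq_abs] at hm
      rw [abs_of_nonneg (Real.rpow_nonneg (Nat.cast_nonneg m) δ)] at hm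
      exact (le_abs_self _).trans hm
  filter_upwards [hlog, eventually_gt_atTop 0] with m hm hm0
  rw [Real.rpow_def_of_pos two_pos]
  exact (Real.log_le_iff_le_exp (by exact_mod_cast hm0)).1 hm

lemma Subexponential.mul {g : GrowthConvention} {f h : ℕ → ℝ} (hf : Subexponential g f)
    (hh : Subexponential g h) (h0 : ∀ m, 0 ≤ h m) : Subexponential g fun m => f m * h m := by
  intro δ hδ
  obtain ⟨δ', hδ', hle⟩ := g.exists_two_mul_exponent_le hδ
  filter_upwards [hf δ' hδ', hh δ' hδ', hle] with m h1 h2 h3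
  calc f m * h m ≤ 2 ^ g.exponent δ' m * 2 ^ g.exponent δ' m :=
        mul_le_mul h1 h2 (h0 m) (by positivity)
    _ = 2 ^ (2 * g.exponent δ' m) := by rw [← Real.rpow_add two_pos, two_mul]
    _ ≤ 2 ^ g.exponent δ m := Real.rpow_le_rpow_of_exponent_le one_le_two h3

lemma Subexponential.pow {g : GrowthConvention} {f : ℕ → ℝ} (hf : Subexponential g f)
    (h0 : ∀ m, 0 ≤ f m) (n : ℕ) : Subexponential g fun m => f m ^ n := by
  induction n with
  | zero => simpa using subexponential_const g 1
  | succ n ih =>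
    simp only [pow_succ]
    exact ih.mul hf h0

lemma Subexponential.add {g : GrowthConvention} {f h : ℕ → ℝ} (hf : Subexponential g f)
    (hh : Subexponential g h) : Subexponential g fun m => f m + h m := by
  intro δ hδ
  obtain ⟨δ', hδ', hle⟩ := g.exists_two_mul_exponent_le hδ
  filter_upwards [hf δ' hδ', hh δ' hδ', subexponential_const g 2 δ' hδ', hle] with m h1 h2 h3 h4
  calc f m + h m ≤ 2 * 2 ^ g.exponent δ' m := by linarith
    _ ≤ 2 ^ g.exponent δ' m * 2 ^ g.exponent δ' m :=
        mul_le_mul_of_nonneg_right h3 (by positivity)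
    _ = 2 ^ (2 * g.exponent δ' m) := by rw [← Real.rpow_add two_pos, two_mul]
    _ ≤ 2 ^ g.exponent δ m := Real.rpow_le_rpow_of_exponent_le one_le_two h4

/-- A subexponential function is eventually strictly below any exponential one. -/
lemma Subexponential.eventually_lt {g : GrowthConvention} {f : ℕ → ℝ} (hf : Subexponential g f)
    {δ : ℝ} (hδ : 0 < δ) : ∀ᶠ m in atTop, f m < 2 ^ g.exponent δ m := by
  filter_upwards [(hf.add (subexponential_const g 1)) δ hδ] with m hm
  linarith

lemma SubDoublyExponential.clog {g : GrowthConvention} {n : ℕ → ℕ}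
    (hn : SubDoublyExponential g fun m => (n m : ℝ)) :
    Subexponential g fun m => (Nat.clog 2 (n m) : ℝ) := by
  intro δ hδ
  obtain ⟨δ', hδ', hle⟩ := g.exists_two_mul_exponent_le hδ
  filter_upwards [hn δ' hδ', subexponential_const g 2 δ' hδ', hle] with m h1 h2 h3
  have h4 : Nat.clog 2 (n m) ≤ ⌈(2 : ℝ) ^ g.exponent δ' m⌉₊ := by
    refine Nat.clog_le_of_le_pow ?_
    have : (n m : ℝ) ≤ (2 : ℝ) ^ (⌈(2 : ℝ) ^ g.exponent δ' m⌉₊ : ℝ) :=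
      h1.trans (Real.rpow_le_rpow_of_exponent_le one_le_two (Nat.le_ceil _))
    rw [Real.rpow_natCast] at this
    exact_mod_cast this
  have h5 := (Nat.ceil_lt_add_one (by positivity : (0 : ℝ) ≤ 2 ^ g.exponent δ' m)).le
  have h6 : (Nat.clog 2 (n m) : ℝ) ≤ ⌈(2 : ℝ) ^ g.exponent δ' m⌉₊ := by exact_mod_cast h4
  calc (Nat.clog 2 (n m) : ℝ) ≤ 2 * 2 ^ g.exponent δ' m := by linarith
    _ ≤ 2 ^ g.exponent δ' m * 2 ^ g.exponent δ' m :=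
        mul_le_mul_of_nonneg_right h2 (by positivity)
    _ = 2 ^ (2 * g.exponent δ' m) := by rw [← Real.rpow_add two_pos, two_mul]
    _ ≤ 2 ^ g.exponent δ m := Real.rpow_le_rpow_of_exponent_le one_le_two h3

end Growth

end CombAuction
theorem mainTheorem3 (g : GrowthConvention)
    -- `m` items and `k m` players, where `k` is subexponential in `m`
    (k : ℕ → ℕ) (hk : Subexponential g (fun m => (k m : ℝ)))
    -- the class of valuations; the values have description length polynomial in `k` and `m`
    (V : ∀ m : ℕ, Set (Valuation m))
    (hV : ∃ d : ℕ, ∀ m, ∀ v ∈ V m, ∀ T, Nat.size (v.val T) ≤ (k m + m + 2) ^ d)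
    -- the parameters of the promise problem
    (W α : ℕ → ℝ) (hW : ∀ m, 0 < W m) (hα : ∀ m, 1 ≤ α m)
    -- `ε` is bounded below by an inverse polynomial function of `k` and `m`
    (ε : ℕ → ℝ) (hε : ∃ d : ℕ, ∀ m, 1 / ((k m + m + 2 : ℕ) : ℝ) ^ d ≤ ε m) :
    -- no protocol with subexponential communication
    ((¬ ∃ P : ∀ m, NondetProtocol (k m) m,
        Subexponential g (fun m => ((P m).cost : ℝ)) ∧
          ∀ᶠ m in atTop, (P m).Solves (V m) (W m) (α m)) →
      ∀ A : ∀ m, Auction (k m) m,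
        SubDoublyExponential g (fun m => ((A m).numStrategies : ℝ)) →
        ∃ᶠ m in atTop, ENNReal.ofReal (α m) ≤ (A m).worstCasePoA (ε m) (V m)) ∧
    -- exponential communication is needed for all large `m`
    ((∃ δ : ℝ, 0 < δ ∧ ∀ᶠ m in atTop, ∀ P : NondetProtocol (k m) m,
        P.Solves (V m) (W m) (α m) → (2 : ℝ) ^ g.exponent δ m ≤ P.cost) →
      ∀ A : ∀ m, Auction (k m) m,
        SubDoublyExponential g (fun m => ((A m).numStrategies : ℝ)) →
        ∀ᶠ m in atTop, ENNReal.ofReal (α m) ≤ (A m).worstCasePoA (ε m) (V m)) := by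
  obtain ⟨d, hd⟩ := hV
  obtain ⟨d', hd'⟩ := hε
  have main : ∀ A : ∀ m, Auction (k m) m,
      SubDoublyExponential g (fun m => ((A m).numStrategies : ℝ)) →
      ∃ C : ℕ → ℕ, Subexponential g (fun m => (C m : ℝ)) ∧
        ∀ m, (A m).worstCasePoA (ε m) (V m) < ENNReal.ofReal (α m) →
          ∃ P : NondetProtocol (k m) m, P.Solves (V m) (W m) (α m) ∧ P.cost ≤ C m := by
    intro A hA
    refine ⟨fun m => (k m + m + 2 + Nat.clog 2 (A m).numStrategies) ^ (2 * d' + d + 13), ?_,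
      fun m hm => (A m).exists_protocol_cost_le (hW m) (hα m) (hd m) (hd' m) hm⟩
    push_cast
    exact (((hk.add (subexponential_natCast g)).add (subexponential_const g 2)).add hA.clog).pow
      (fun m => by positivity) _
  constructor
  · intro hno A hA
    obtain ⟨C, hC, hP⟩ := main A hA
    by_contra hcon
    rw [not_frequently] at hcon
    have hex : ∀ m, ∃ P : NondetProtocol (k m) m, P.cost ≤ C m ∧
        ((A m).worstCasePoA (ε m) (V m) < ENNReal.ofReal (α m) →
          P.Solves (V m) (W m) (α m)) := by
      intro m
      by_cases h : (A m).worstCasePoA (ε m) (V m) < ENNReal.ofReal (α m)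
      · obtain ⟨P, hs, hc⟩ := hP m h
        exact ⟨P, hc, fun _ => hs⟩
      -- A protocol is needed for every `m`; a free dummy serves where the price of anarchy is at
      -- least `α`, which is excluded for large `m`.
      · exact ⟨⟨0, fun _ _ _ => True⟩, Nat.zero_le _, fun h' => absurd h' h⟩
    choose P hc hs using hex
    refine hno ⟨P, hC.mono (Eventually.of_forall fun m => by exact_mod_cast hc m), ?_⟩
    filter_upwards [hcon] with m hm using hs m (not_le.1 hm)
  · rintro ⟨δ, hδ, hlow⟩ A hA
    obtain ⟨C, hC, hP⟩ := main A hA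
    filter_upwards [hlow, hC.eventually_lt hδ] with m h1 h2
    by_contra hcon
    obtain ⟨P, hs, hc⟩ := hP m (not_le.1 hcon)
    have h3 := h1 P hs
    have h4 : (P.cost : ℝ) ≤ C m := by exact_mod_cast hc
    linarith
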